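/- Let $\Lambda=\mathbb Z[t^{\pm1}]$. For a diagram $D$ of an oriented link $L$, let $A(D)$ be the set of arcs (the components of $L$ cut at the underpasses; a component without underpasses is a single arc) and $C(D)$ the set of crossings. For $c\in C(D)$ let $a(c)$ be the overpassing arc, and let $b_1(c)$ and $b_2(c)$ be the underpassing arcs on the right and on the left of $a(c)$, respectively. The medial quandle $\mathrm{MQ}(L)$ is the medial quandle (that is, quandle satisfying $(w\triangleright x)\triangleright(y\triangleright z)=(w\triangleright y)\triangleright(x\triangleright z)$) with a generator $q_a$ for each $a\in A(D)$ and a relation $q_{b_1(c)}\triangleright q_{a(c)}=q_{b_2(c)}$ for each $c\in C(D)$. The reduced Alexander module $M_A^{\mathrm{red}}(L)$ is the cokernel of the $\Lambda$-linear map $\Lambda^{C(D)}\to\Lambda^{A(D)}$, $c\mapsto(1-t)\,a(c)+t\,b_1(c)-b_2(c)$, and the reduced Alexander invariant of $L$ is the kernel of the $\Lambda$-linear map $\phi_L^{\mathrm{red}}:M_A^{\mathrm{red}}(L)\to\Lambda$ that sends the generator of every arc to $1$. Theorem. Let $L$ and $L'$ be classical oriented 2-component links, given by diagrams without virtual crossings.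 Then the quandles $\mathrm{MQ}(L)$ and $\mathrm{MQ}(L')$ are isomorphic if and only if the $\Lambda$-modules $\ker\phi_L^{\mathrm{red}}$ and $\ker\phi_{L'}^{\mathrm{red}}$ are isomorphic. -/

import Mathlib

open scoped LaurentPolynomial Quandles

/-! ### Medial quandles given by generators and relations

We use Mathlib's quandles, whose operation `x ◃ y` is the action of `x` on `y`; it corresponds to
`y ▷ x` in the right-handed notation. A quandle is medial when
`(w ▷ x) ▷ (y ▷ z) = (w ▷ y) ▷ (x ▷ z)`, which is Mathlib's `Rack.IsAbelian`. -/

/-- Formal words in the two quandle operations. -/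
inductive QuandleWord (A : Type) : Type
  | gen (a : A) : QuandleWord A
  | act (x y : QuandleWord A) : QuandleWord A
  | invAct (x y : QuandleWord A) : QuandleWord A

/-- The smallest congruence on words that contains the axioms of a medial quandle and the relations
`a ◃ b = b'` for all generators with `R a b b'`. -/
inductive MedialRel {A : Type} (R : A → A → A → Prop) : QuandleWord A → QuandleWord A → Prop
  | refl (x) : MedialRel R x x
  | symm {x y} : MedialRel R x y → MedialRel R y x
  | trans {x y z} : MedialRel R x y → MedialRel R y z → MedialRel R x z
  | act_congr {x x' y y'} : MedialRel R x x' → MedialRel R y y' →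
      MedialRel R (.act x y) (.act x' y')
  | invAct_congr {x x' y y'} : MedialRel R x x' → MedialRel R y y' →
      MedialRel R (.invAct x y) (.invAct x' y')
  | self_distrib (x y z) : MedialRel R (.act x (.act y z)) (.act (.act x y) (.act x z))
  | left_inv (x y) : MedialRel R (.invAct x (.act x y)) y
  | right_inv (x y) : MedialRel R (.act x (.invAct x y)) y
  | fix (x) : MedialRel R (.act x x) x
  | medial (x y z w) :
      MedialRel R (.act (.act x y) (.act z w)) (.act (.act x z) (.act y w))
  | rel {a b b'} : R a b b' → MedialRel R (.act (.gen a) (.gen b)) (.gen b')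

/-- The congruence `MedialRel R` as a setoid. -/
def medialSetoid {A : Type} (R : A → A → A → Prop) : Setoid (QuandleWord A) where
  r := MedialRel R
  iseqv := ⟨.refl, .symm, .trans⟩

/-- The medial quandle generated by `A` subject to the relations `a ◃ b = b'` for `R a b b'`. -/
def PresentedMedialQuandle {A : Type} (R : A → A → A → Prop) : Type :=
  Quotient (medialSetoid R)

instance {A : Type} (R : A → A → A → Prop) : Quandle (PresentedMedialQuandle R) where
  act := Quotient.map₂ .act fun _ _ h _ _ h' => MedialRel.act_congr h h'
  invAct := Quotient.map₂ .invAct fun _ _ h _ _ h' => MedialRel.invAct_congr h h'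
  self_distrib {x y z} := Quotient.inductionOn₃ x y z fun x y z =>
    Quotient.sound (MedialRel.self_distrib x y z)
  left_inv x y := Quotient.inductionOn₂ x y fun x y => Quotient.sound (MedialRel.left_inv x y)
  right_inv x y := Quotient.inductionOn₂ x y fun x y => Quotient.sound (MedialRel.right_inv x y)
  fix {x} := Quotient.inductionOn x fun x => Quotient.sound (MedialRel.fix x)

/-! ### Link diagrams -/

/-- A passage of a link diagram through a classical crossing, on the upper or the lower strand. -/
inductive Passage (C : Type) : Type
  | over (c : C) : Passage C
  | under (c : C) : Passage C

/-- A half-edge of a link diagram at a crossing: the half-edge along which a strand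
enters the crossing or leaves it. -/
inductive HalfEdge (C : Type) : Type
  | enter (p : Passage C) : HalfEdge C
  | leave (p : Passage C) : HalfEdge C

/-- An oriented virtual link diagram up to detour moves, recorded as a signed Gauss diagram.
Every crossing is passed twice, once over and once under; following the orientation of the link,
one comes from the passage `p` to the passage `next p`. Components without classical crossings are
counted separately. A crossing is positive if the lower strand crosses from the right to the left
of the upper strand, and negative otherwise. -/
structure LinkDiagram where
  Crossing : Type
  [fintypeCrossing : Fintype Crossing]
  next : Equiv.Perm (Passage Crossing)
  positive : Crossing → Bool
  numFreeCircles : ℕ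

namespace LinkDiagram

variable (D : LinkDiagram)

/-- The components: the cycles of `next`, and the circles without classical crossings. -/
def Component : Type :=
  Quotient (Equiv.Perm.SameCycle.setoid D.next) ⊕ Fin D.numFreeCircles

/-- The edge that leaves the passage `p` and the edge that leaves the passage `next p` belong to
the same arc if `next p` is an overpass. -/
inductive Continues : Passage D.Crossing → Passage D.Crossing → Prop
  | mk (p : Passage D.Crossing) (c : D.Crossing) (h : D.next p = .over c) : Continues p (.over c)

/-- The arcs of the diagram, obtained by cutting the components at the underpasses. An edge is named
by the passage that it leaves. -/
def Arc : Type := Quot D.Continues ⊕ Fin D.numFreeCircles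

/-- The arc that contains the edge leaving the passage `p`. -/
def arcAfter (p : Passage D.Crossing) : D.Arc := .inl (Quot.mk _ p)

/-- The overpassing arc at a crossing. -/
def overArc (c : D.Crossing) : D.Arc := D.arcAfter (.over c)

/-- The underpassing arc on which one arrives at a crossing. -/
def underIn (c : D.Crossing) : D.Arc := D.arcAfter (D.next.symm (.under c))

/-- The underpassing arc on which one leaves a crossing. -/
def underOut (c : D.Crossing) : D.Arc := D.arcAfter (.under c)

/-- The underpassing arc on the right of the overpassing arc. -/
def rightArc (c : D.Crossing) : D.Arc := if D.positive c then D.underIn c else D.underOut c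

/-- The underpassing arc on the left of the overpassing arc. -/
def leftArc (c : D.Crossing) : D.Arc := if D.positive c then D.underOut c else D.underIn c

/-! #### Classical diagrams -/

/-- The half-edge that follows counterclockwise around the crossing. -/
def ccw : HalfEdge D.Crossing → HalfEdge D.Crossing
  | .leave (.over c) => if D.positive c then .leave (.under c) else .enter (.under c)
  | .enter (.over c) => if D.positive c then .enter (.under c) else .leave (.under c)
  | .leave (.under c) => if D.positive c then .enter (.over c) else .leave (.over c)
  | .enter (.under c) => if D.positive c then .leave (.over c) else .enter (.over c)

/-- The half-edge that follows clockwise around the crossing. -/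
def cw : HalfEdge D.Crossing → HalfEdge D.Crossing
  | .leave (.over c) => if D.positive c then .enter (.under c) else .leave (.under c)
  | .enter (.over c) => if D.positive c then .leave (.under c) else .enter (.under c)
  | .leave (.under c) => if D.positive c then .leave (.over c) else .enter (.over c)
  | .enter (.under c) => if D.positive c then .enter (.over c) else .leave (.over c)

/-- Counterclockwise rotation of the half-edges around the crossings. -/
def rotation : Equiv.Perm (HalfEdge D.Crossing) where
  toFun := D.ccw
  invFun := D.cw
  left_inv := by
    rintro ((c | c) | (c | c)) <;> cases h : D.positive c <;> simp [ccw, cw, h]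
  right_inv := by
    rintro ((c | c) | (c | c)) <;> cases h : D.positive c <;> simp [ccw, cw, h]

/-- The other half of the same edge. -/
def otherHalf : HalfEdge D.Crossing → HalfEdge D.Crossing
  | .leave p => .enter (D.next p)
  | .enter p => .leave (D.next.symm p)

/-- Exchange of the two halves of every edge. -/
def edgeFlip : Equiv.Perm (HalfEdge D.Crossing) where
  toFun := D.otherHalf
  invFun := D.otherHalf
  left_inv := by rintro (p | p) <;> simp [otherHalf]
  right_inv := by rintro (p | p) <;> simp [otherHalf]

/-- The faces of the closed oriented surface on which the diagram is cellularly drawn, given as the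
closed walks around them. -/
def Face : Type :=
  Quotient (Equiv.Perm.SameCycle.setoid (D.rotation * D.edgeFlip))

/-- The connected pieces of the 4-valent graph formed by the crossings and the edges. -/
def Piece : Type :=
  MulAction.orbitRel.Quotient
    (Subgroup.closure {D.rotation, D.edgeFlip}) (HalfEdge D.Crossing)

/-- The diagram is classical: it can be drawn in the plane without virtual crossings. This is
Euler's formula `V - E + F = 2 k` with `k` the number of connected pieces; as
`V - E + F ≤ 2` on every piece, it says that every piece has genus zero. -/
def IsClassical : Prop :=
  (Nat.card D.Crossing : ℤ) - Nat.card (Passage D.Crossing) + Nat.card D.Face =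
    2 * Nat.card D.Piece

/-! #### The invariants -/

/-- The relations `b₁(c) ▷ a(c) = b₂(c)`, that is, `a(c) ◃ b₁(c) = b₂(c)`, for the crossings `c`,
where `a(c)` is the overpassing arc, `b₁(c)` the arc on its right and `b₂(c)` the arc on its
left. -/
inductive CrossingRel : D.Arc → D.Arc → D.Arc → Prop
  | mk (c : D.Crossing) : CrossingRel (D.overArc c) (D.rightArc c) (D.leftArc c)

/-- The medial quandle of a link. -/
abbrev MedialQuandle : Type := PresentedMedialQuandle D.CrossingRel

/-- The element `(1 - t) a(c) + t b₁(c) - b₂(c)` of the free `ℤ[t, t⁻¹]`-module on the arcs. -/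
noncomputable def relator (c : D.Crossing) : D.Arc →₀ ℤ[T;T⁻¹] :=
  Finsupp.single (D.overArc c) (1 - LaurentPolynomial.T 1) +
    Finsupp.single (D.rightArc c) (LaurentPolynomial.T 1) - Finsupp.single (D.leftArc c) 1

/-- The `ℤ[t, t⁻¹]`-linear map with the crossing relators as its values on the basis. -/
noncomputable def reducedRho : (D.Crossing →₀ ℤ[T;T⁻¹]) →ₗ[ℤ[T;T⁻¹]] (D.Arc →₀ ℤ[T;T⁻¹]) :=
  Finsupp.linearCombination ℤ[T;T⁻¹] D.relator

/-- The reduced Alexander module. -/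
abbrev ReducedAlexanderModule : Type :=
  (D.Arc →₀ ℤ[T;T⁻¹]) ⧸ LinearMap.range D.reducedRho

/-- The reduced Crowell map, which sends the generator of every arc to `1`. -/
noncomputable def reducedCrowellMap : D.ReducedAlexanderModule →ₗ[ℤ[T;T⁻¹]] ℤ[T;T⁻¹] :=
  (LinearMap.range D.reducedRho).liftQ
    (Finsupp.linearCombination ℤ[T;T⁻¹] fun _ : D.Arc => (1 : ℤ[T;T⁻¹])) (by
      rw [LinearMap.range_le_ker_iff]
      ext c
      simp [reducedRho, relator])

/-- The reduced Alexander invariant. -/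
noncomputable abbrev ReducedAlexanderInvariant :
    Submodule ℤ[T;T⁻¹] D.ReducedAlexanderModule :=
  LinearMap.ker D.reducedCrowellMap

end LinkDiagram

/-! Write `Λ = ℤ[T;T⁻¹]`, `M` for the reduced Alexander module, `φ` for its Crowell map and `K = ker
φ`. Every `Λ`-module is a medial quandle under `(1 - t) x + t y`, and `alexanderMap : MQ(L) → M` is
the universal map of this kind to a module. An isomorphism of medial quandles therefore induces one
of the modules `M`. It respects `φ`, because `φ` is `1` on the images of all quandle elements, so it
restricts to the kernels.

For the converse, the quandle is recovered as a subset of `M`. Displacements of a medial quandle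
commute and form a `Λ`-module, with `t` acting as conjugation by a base point. By universality `M`
acts on `MQ(L)` (`move`), and under `alexanderMap` an element `m` of `K` acts as translation by `(1
- t) m` (`alexanderMap_move_of_mem`). Every element is moved by `K` from some arc, and arcs of one
component are moved to each other, so the image is a union of two cosets of `(1 - t) K`, one per
component.

Injectivity of `alexanderMap` needs a classical link with two components. Elements of `K` inducing
the same translation differ by something killed by `1 - t`, which is an integral combination of
longitudes (`exists_eq_sum_passageShift`). A longitude fixes the arcs of its own component
(`move_longitude`). The sum of all longitudes is zero (`IsClassical.sum_crossingShift`), a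
consequence of the Alexander numbering that exists because planar diagrams live on surfaces without
first homology. With two components, either longitude is thus minus the other, and both act
trivially.

Finally `K / (1 - t) K` is infinite cyclic, generated by the difference of arcs of the two
components. An isomorphism of kernels preserves this generator up to sign. After a change of sign it
matches the two cosets (`exists_equiv_difference`) and, as an affine map, restricts to a quandle
isomorphism. -/

/-! ### Laurent polynomials -/

namespace LaurentPolynomial

/-- The augmentation `ℤ[t, t⁻¹] → ℤ`, `t ↦ 1`. -/
noncomputable def augmentation : ℤ[T;T⁻¹] →+* ℤ := eval₂ (RingHom.id ℤ) 1

@[simp]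
theorem augmentation_T (n : ℤ) : augmentation (T n) = 1 := by simp [augmentation]

@[simp]
theorem augmentation_C (n : ℤ) : augmentation (C n) = n := by simp [augmentation]

theorem one_sub_T_ne_zero : (1 - T 1 : ℤ[T;T⁻¹]) ≠ 0 := by
  intro h
  -- At `t = -1` the element takes the value 2.
  have h' := congrArg (eval₂ (RingHom.id ℤ) (-1 : ℤˣ)) h
  simp at h'

theorem one_sub_T_dvd_one_sub_T (n : ℤ) : (1 - T 1 : ℤ[T;T⁻¹]) ∣ 1 - T n := by
  induction n using Int.induction_on with
  | zero => simp
  | succ n ih =>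
    rw [show (1 - T (n + 1) : ℤ[T;T⁻¹]) = (1 - T n) + T n * (1 - T 1) by rw [T_add]; ring]
    exact dvd_add ih (dvd_mul_left _ _)
  | pred n ih =>
    rw [show (1 - T (-n - 1) : ℤ[T;T⁻¹]) = (1 - T (-n)) - T (-n - 1) * (1 - T 1) by
      rw [mul_sub, ← T_add]; simp]
    exact dvd_sub ih (dvd_mul_left _ _)

/-- `1 - t` generates the augmentation ideal. This splits the coefficients of a relation into
integers and multiples of `1 - t`. -/
theorem exists_eq_C_augmentation_add (p : ℤ[T;T⁻¹]) :
    ∃ q, p = C (augmentation p) + (1 - T 1) * q := by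
  induction p using LaurentPolynomial.induction_on' with
  | add p q hp hq =>
    obtain ⟨p', hp⟩ := hp
    obtain ⟨q', hq⟩ := hq
    refine ⟨p' + q', ?_⟩
    conv_lhs => rw [hp, hq]
    simp only [map_add]
    ring
  | C_mul_T n a =>
    obtain ⟨q, hq⟩ := one_sub_T_dvd_one_sub_T n
    refine ⟨-(C a * q), ?_⟩
    simp only [map_mul, augmentation_C, augmentation_T, mul_one]
    linear_combination (-C a) * hq

/-- A property that is closed under sums and under `t` and `t⁻¹` is closed under scalars. -/
theorem smul_induction {M : Type*} [AddCommGroup M] [Module ℤ[T;T⁻¹] M] (S : AddSubgroup M)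
    (hT : ∀ m ∈ S, (T 1 : ℤ[T;T⁻¹]) • m ∈ S) (hT' : ∀ m ∈ S, (T (-1) : ℤ[T;T⁻¹]) • m ∈ S)
    (p : ℤ[T;T⁻¹]) {m : M} (hm : m ∈ S) : p • m ∈ S := by
  have key (n : ℤ) : ∀ m ∈ S, (T n : ℤ[T;T⁻¹]) • m ∈ S := by
    induction n using Int.induction_on with
    | zero => simp
    | succ n ih =>
      intro m hm
      rw [T_add, mul_smul]
      exact ih _ (hT _ hm)
    | pred n ih =>
      intro m hm
      rw [sub_eq_add_neg, T_add, mul_smul]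
      exact ih _ (hT' _ hm)
  induction p using LaurentPolynomial.induction_on' with
  | add p q hp hq =>
    rw [add_smul]
    exact S.add_mem hp hq
  | C_mul_T n a =>
    rw [mul_smul, eq_intCast (C : ℤ →+* ℤ[T;T⁻¹]) a, Int.cast_smul_eq_zsmul]
    exact S.zsmul_mem (key n m hm) a

end LaurentPolynomial

/-! ### The displacement group of a medial quandle -/

namespace Rack

open LaurentPolynomial

/-- The group generated by the displacements `z ↦ x ◃ (y ◃⁻¹ z)`. -/
def displacementGroup (Q : Type*) [Rack Q] : Subgroup (Equiv.Perm Q) :=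
  Subgroup.closure {g | ∃ x y : Q, g = act' x * (act' y)⁻¹}

section

variable {Q : Type*} [Rack Q]

theorem act'_mul_inv_mem (x y : Q) : act' x * (act' y)⁻¹ ∈ displacementGroup Q :=
  Subgroup.subset_closure ⟨x, y, rfl⟩

theorem act'_invAct (x y : Q) : act' (x ◃⁻¹ y) = (act' x)⁻¹ * act' y * act' x := by
  have h := ad_conj x (x ◃⁻¹ y)
  rw [act_invAct_eq] at h
  rw [h]
  group

theorem conj_mem_displacementGroup (o : Q) {g : Equiv.Perm Q} (hg : g ∈ displacementGroup Q) :
    act' o * g * (act' o)⁻¹ ∈ displacementGroup Q := by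
  induction hg using Subgroup.closure_induction with
  | mem g hg =>
    obtain ⟨x, y, rfl⟩ := hg
    have h := act'_mul_inv_mem (o ◃ x) (o ◃ y)
    rw [ad_conj, ad_conj] at h
    convert h using 1
    group
  | one => simp
  | mul x y _ _ hx hy =>
    convert mul_mem hx hy using 1
    group
  | inv x _ hx =>
    convert inv_mem hx using 1
    group

theorem inv_conj_mem_displacementGroup (o : Q) {g : Equiv.Perm Q}
    (hg : g ∈ displacementGroup Q) : (act' o)⁻¹ * g * act' o ∈ displacementGroup Q := by
  induction hg using Subgroup.closure_induction with
  | mem g hg =>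
    obtain ⟨x, y, rfl⟩ := hg
    have h := act'_mul_inv_mem (o ◃⁻¹ x) (o ◃⁻¹ y)
    rw [act'_invAct, act'_invAct] at h
    convert h using 1
    group
  | one => simp
  | mul x y _ _ hx hy =>
    convert mul_mem hx hy using 1
    group
  | inv x _ hx =>
    convert inv_mem hx using 1
    group

/-- Mediality reads `act' (x ◃ y) * act' z = act' (x ◃ z) * act' y`. Both `act' (x ◃ y)` and `act'
(x ◃ z)` are conjugates by `act' x`, and the leading factor `act' x` cancels. -/
theorem IsAbelian.act'_mul_inv_mul (h : IsAbelian Q) (x y z : Q) :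
    act' y * (act' x)⁻¹ * act' z = act' z * (act' x)⁻¹ * act' y := by
  have h' : act' (x ◃ y) * act' z = act' (x ◃ z) * act' y := by
    ext w
    exact h x y z w
  rw [ad_conj, ad_conj] at h'
  simpa only [mul_assoc, mul_right_inj] using h'

/-- The identity `a b⁻¹ c = c b⁻¹ a` and its inverted form `b⁻¹ a d⁻¹ = d⁻¹ a b⁻¹` exchange the
outer letters in turn. -/
theorem IsAbelian.commute_displacements (h : IsAbelian Q) (a b c d : Q) :
    Commute (act' a * (act' b)⁻¹) (act' c * (act' d)⁻¹) := by
  have h₁ := h.act'_mul_inv_mul b a c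
  have h₂ := congrArg (·⁻¹) (h.act'_mul_inv_mul a b d)
  simp only [mul_inv_rev, inv_inv, ← mul_assoc] at h₂
  calc act' a * (act' b)⁻¹ * (act' c * (act' d)⁻¹)
      = act' a * (act' b)⁻¹ * act' c * (act' d)⁻¹ := by group
    _ = act' c * ((act' b)⁻¹ * act' a * (act' d)⁻¹) := by rw [h₁]; group
    _ = act' c * ((act' d)⁻¹ * act' a * (act' b)⁻¹) := by
      rw [h₂]
    _ = _ := by group

theorem IsAbelian.displacementGroup_comm (h : IsAbelian Q) (d e : displacementGroup Q) :
    d * e = e * d := by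
  have hc := Subgroup.isMulCommutative_closure (k := {g | ∃ x y : Q, g = act' x * (act' y)⁻¹}) (by
    rintro _ ⟨a, b, rfl⟩ _ ⟨c, d, rfl⟩
    exact h.commute_displacements a b c d)
  exact hc.is_comm.comm d e

end

/-- The displacement group of a medial rack, written additively. The base point `o` determines the
action of `t` by conjugation. -/
def Displacement {Q : Type*} [Rack Q] (_h : IsAbelian Q) (_o : Q) : Type _ :=
  Additive (displacementGroup Q)

namespace Displacement

variable {Q : Type*} [Rack Q] {h : IsAbelian Q} {o : Q}

instance : AddCommGroup (Displacement h o) :=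
  { (inferInstance : AddGroup (Additive (displacementGroup Q))) with
    add_comm := fun a b => h.displacementGroup_comm a.toMul b.toMul }

/-- The permutation of the rack given by a displacement. -/
def toPerm (d : Displacement h o) : Equiv.Perm Q := (Additive.toMul d : displacementGroup Q).1

variable (h o) in
/-- A permutation in the displacement group as a displacement. -/
def ofPerm (g : Equiv.Perm Q) (hg : g ∈ displacementGroup Q) : Displacement h o :=
  Additive.ofMul ⟨g, hg⟩

@[simp]
theorem toPerm_ofPerm (g : Equiv.Perm Q) (hg) : toPerm (ofPerm h o g hg) = g := rfl

@[simp]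
theorem toPerm_add (d e : Displacement h o) : toPerm (d + e) = toPerm d * toPerm e := rfl

@[simp]
theorem toPerm_zero : toPerm (0 : Displacement h o) = 1 := rfl

@[simp]
theorem toPerm_neg (d : Displacement h o) : toPerm (-d) = (toPerm d)⁻¹ := rfl

theorem toPerm_injective : Function.Injective (toPerm : Displacement h o → Equiv.Perm Q) :=
  fun _ _ hde => Subtype.ext hde

theorem toPerm_mem (d : Displacement h o) : toPerm d ∈ displacementGroup Q :=
  (Additive.toMul d : displacementGroup Q).2

variable (h o) in
/-- Conjugation by the action of the base point. -/
def conj : (AddMonoid.End (Displacement h o))ˣ where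
  val :=
    { toFun := fun d => ofPerm h o _ (conj_mem_displacementGroup o (toPerm_mem d))
      map_zero' := toPerm_injective (by simp)
      map_add' := fun d e => toPerm_injective (by simp) }
  inv :=
    { toFun := fun d => ofPerm h o _ (inv_conj_mem_displacementGroup o (toPerm_mem d))
      map_zero' := toPerm_injective (by simp)
      map_add' := fun d e => toPerm_injective (by simp [mul_assoc]) }
  val_inv :=
    AddMonoidHom.ext fun d => toPerm_injective
      (show act' o * ((act' o)⁻¹ * toPerm d * act' o) * (act' o)⁻¹ = toPerm d by group)
  inv_val :=
    AddMonoidHom.ext fun d => toPerm_injective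
      (show (act' o)⁻¹ * (act' o * toPerm d * (act' o)⁻¹) * act' o = toPerm d by group)

variable (h o) in
/-- The action of the Laurent polynomials on the displacements, in which `t` acts by `conj`. -/
noncomputable def scalarHom : ℤ[T;T⁻¹] →+* AddMonoid.End (Displacement h o) :=
  (AddMonoidAlgebra.lift ℤ (AddMonoid.End (Displacement h o)) ℤ
    ((Units.coeHom _).comp (zpowersHom _ (conj h o)))).toRingHom

theorem scalarHom_T (n : ℤ) : scalarHom h o (T n) = (conj h o ^ n).val := by
  simp [scalarHom, T, -single_eq_C_mul_T]

noncomputable instance : Module ℤ[T;T⁻¹] (Displacement h o) :=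
  Module.compHom _ (scalarHom h o)

@[simp]
theorem toPerm_T_one_smul (d : Displacement h o) :
    toPerm ((T 1 : ℤ[T;T⁻¹]) • d) = act' o * toPerm d * (act' o)⁻¹ := by
  change toPerm (scalarHom h o (T 1) d) = _
  rw [scalarHom_T, zpow_one]
  rfl

@[simp]
theorem toPerm_T_neg_one_smul (d : Displacement h o) :
    toPerm ((T (-1) : ℤ[T;T⁻¹]) • d) = (act' o)⁻¹ * toPerm d * act' o := by
  change toPerm (scalarHom h o (T (-1)) d) = _
  rw [scalarHom_T, zpow_neg_one]
  rfl

variable (h o) in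
/-- The displacement from the base point to `x`. -/
def ofElement (x : Q) : Displacement h o := ofPerm h o _ (act'_mul_inv_mem x o)

theorem toPerm_ofElement_sub (x y : Q) :
    toPerm (ofElement h o x - ofElement h o y) = act' x * (act' y)⁻¹ := by
  simp [sub_eq_add_neg, ofElement, mul_assoc]

/-- Multiplicatively, `x y x⁻¹ o⁻¹` is the product of `x o⁻¹`, `o (y o⁻¹) o⁻¹` and the inverse of `o
(x o⁻¹) o⁻¹`. This is why `t` is made to act as conjugation by `o`. -/
theorem ofElement_act (x y : Q) :
    ofElement h o (x ◃ y) =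
      (1 - T 1 : ℤ[T;T⁻¹]) • ofElement h o x + (T 1 : ℤ[T;T⁻¹]) • ofElement h o y := by
  have : (1 - T 1 : ℤ[T;T⁻¹]) • ofElement h o x + (T 1 : ℤ[T;T⁻¹]) • ofElement h o y =
      ofElement h o x + (T 1 : ℤ[T;T⁻¹]) • ofElement h o y -
        (T 1 : ℤ[T;T⁻¹]) • ofElement h o x := by
    rw [sub_smul, one_smul]
    abel
  rw [this]
  apply toPerm_injective
  simp [sub_eq_add_neg, ofElement, mul_assoc, ad_conj]

end Displacement

end Rack

open LaurentPolynomial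

/-! ### Presented medial quandles and maps to modules -/

namespace PresentedMedialQuandle

variable {A : Type} {R : A → A → A → Prop}

/-- The generators of a presented medial quandle. -/
def of (a : A) : PresentedMedialQuandle R := Quotient.mk _ (.gen a)

theorem isAbelian : Rack.IsAbelian (PresentedMedialQuandle R) := fun x y z w =>
  Quotient.inductionOn₂ x y fun x y => Quotient.inductionOn₂ z w fun z w =>
    Quotient.sound (MedialRel.medial x y z w)

theorem of_act_of {a b b' : A} (h : R a b b') :
    (of a : PresentedMedialQuandle R) ◃ of b = of b' :=
  Quotient.sound (MedialRel.rel h)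

theorem induction {P : PresentedMedialQuandle R → Prop} (gen : ∀ a, P (of a))
    (act : ∀ x y, P x → P y → P (x ◃ y)) (invAct : ∀ x y, P x → P y → P (x ◃⁻¹ y))
    (x : PresentedMedialQuandle R) : P x := by
  refine Quotient.inductionOn x fun w => ?_
  induction w with
  | gen a => exact gen a
  | act x y hx hy => exact act _ _ hx hy
  | invAct x y hx hy => exact invAct _ _ hx hy

end PresentedMedialQuandle

/-- A map from a rack to a `ℤ[t, t⁻¹]`-module that turns `x ◃ y` into `(1 - t) x + t y`. -/
def IsAlexanderMap {Q N : Type*} [Rack Q] [AddCommGroup N] [Module ℤ[T;T⁻¹] N] (g : Q → N) : Prop :=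
  ∀ x y, g (x ◃ y) = (1 - T 1 : ℤ[T;T⁻¹]) • g x + (T 1 : ℤ[T;T⁻¹]) • g y

namespace IsAlexanderMap

variable {Q N : Type*} [Rack Q] [AddCommGroup N] [Module ℤ[T;T⁻¹] N] {g : Q → N}

theorem map_invAct (hg : IsAlexanderMap g) (x y : Q) :
    g (x ◃⁻¹ y) = (T (-1) : ℤ[T;T⁻¹]) • (g y - (1 - T 1 : ℤ[T;T⁻¹]) • g x) := by
  have h := hg x (x ◃⁻¹ y)
  rw [Rack.act_invAct_eq] at h
  rw [h, add_sub_cancel_left, smul_smul, ← T_add]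
  simp

theorem map_displacement (hg : IsAlexanderMap g) (x y z : Q) :
    g (x ◃ y ◃⁻¹ z) = g z + (1 - T 1 : ℤ[T;T⁻¹]) • (g x - g y) := by
  rw [hg, hg.map_invAct, smul_smul, ← T_add]
  simp only [add_neg_cancel, T_zero, one_smul, smul_sub]
  abel

theorem linearMap_comp {N' : Type*} [AddCommGroup N'] [Module ℤ[T;T⁻¹] N'] (hg : IsAlexanderMap g)
    (f : N →ₗ[ℤ[T;T⁻¹]] N') : IsAlexanderMap fun x => f (g x) := fun x y => by
  simp only [hg x y, map_add, map_smul]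

theorem comp_shelfHom {Q' : Type*} [Rack Q'] (hg : IsAlexanderMap g) (f : Q' →◃ Q) :
    IsAlexanderMap fun x => g (f x) := fun x y => by
  simp only [ShelfHom.map_act, hg (f x) (f y)]

end IsAlexanderMap

theorem PresentedMedialQuandle.alexanderMap_ext {A : Type} {R : A → A → A → Prop} {N : Type*}
    [AddCommGroup N] [Module ℤ[T;T⁻¹] N] {g g' : PresentedMedialQuandle R → N}
    (hg : IsAlexanderMap g) (hg' : IsAlexanderMap g') (h : ∀ a, g (of a) = g' (of a)) (x) :
    g x = g' x := by
  induction x using PresentedMedialQuandle.induction with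
  | gen a => exact h a
  | act x y hx hy => rw [hg, hg', hx, hy]
  | invAct x y hx hy => rw [hg.map_invAct, hg'.map_invAct, hx, hy]

/-- A word in a presented medial quandle evaluated in a module. -/
noncomputable def QuandleWord.eval {A : Type} {N : Type*} [AddCommGroup N] [Module ℤ[T;T⁻¹] N]
    (f : A → N) : QuandleWord A → N
  | .gen a => f a
  | .act x y => (1 - T 1 : ℤ[T;T⁻¹]) • x.eval f + (T 1 : ℤ[T;T⁻¹]) • y.eval f
  | .invAct x y => (T (-1) : ℤ[T;T⁻¹]) • (y.eval f - (1 - T 1 : ℤ[T;T⁻¹]) • x.eval f)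

/-- The operation `(1 - t) x + t y` satisfies all axioms of a medial quandle in any module, so only
the relations `R` impose a condition, namely `hf`. -/
theorem MedialRel.eval_eq {A : Type} {R : A → A → A → Prop} {N : Type*} [AddCommGroup N]
    [Module ℤ[T;T⁻¹] N] {f : A → N}
    (hf : ∀ a b b', R a b b' → f b' = (1 - T 1 : ℤ[T;T⁻¹]) • f a + (T 1 : ℤ[T;T⁻¹]) • f b)
    {x y : QuandleWord A} (h : MedialRel R x y) : x.eval f = y.eval f := by
  have hT : (T (-1) * T 1 : ℤ[T;T⁻¹]) = 1 := by rw [← T_add]; simp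
  induction h with
  | refl => rfl
  | symm _ ih => exact ih.symm
  | trans _ _ ih ih' => exact ih.trans ih'
  | act_congr _ _ ih ih' => simp only [QuandleWord.eval, ih, ih']
  | invAct_congr _ _ ih ih' => simp only [QuandleWord.eval, ih, ih']
  | self_distrib => simp only [QuandleWord.eval]; module
  | left_inv x y =>
    simp only [QuandleWord.eval, add_sub_cancel_left, smul_smul, hT, one_smul]
  | right_inv x y =>
    rw [mul_comm] at hT
    simp only [QuandleWord.eval, smul_smul, hT, one_smul, add_sub_cancel]
  | fix => simp only [QuandleWord.eval]; module
  | medial => simp only [QuandleWord.eval]; module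
  | rel h => exact (hf _ _ _ h).symm

/-- The integers, on which `t` acts trivially. -/
structure AugmentedInt : Type where
  toInt : ℤ

namespace AugmentedInt

/-- The integers with trivial action of `t` as a copy of the integers. -/
def equivInt : AugmentedInt ≃ ℤ where
  toFun := toInt
  invFun := mk
  left_inv _ := rfl
  right_inv _ := rfl

instance : AddCommGroup AugmentedInt := equivInt.addCommGroup

/-- The additive equivalence with the integers. -/
def addEquivInt : AugmentedInt ≃+ ℤ := equivInt.addEquiv

noncomputable instance : Module ℤ[T;T⁻¹] AugmentedInt :=
  letI : Module ℤ AugmentedInt := equivInt.module ℤ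
  Module.compHom AugmentedInt augmentation

@[simp]
theorem toInt_smul (p : ℤ[T;T⁻¹]) (n : AugmentedInt) : (p • n).toInt = augmentation p * n.toInt :=
  rfl

@[simp]
theorem toInt_add (m n : AugmentedInt) : (m + n).toInt = m.toInt + n.toInt := rfl

end AugmentedInt

/-! ### The reduced Alexander module -/

namespace LinkDiagram

attribute [instance] fintypeCrossing

variable (D : LinkDiagram)

/-- The generator of the medial quandle given by an arc. -/
def arcElement (a : D.Arc) : D.MedialQuandle := PresentedMedialQuandle.of a

/-- The generator of the reduced Alexander module given by an arc. -/
noncomputable def arcClass (a : D.Arc) : D.ReducedAlexanderModule :=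
  (LinearMap.range D.reducedRho).mkQ (Finsupp.single a 1)

theorem arcElement_act (c : D.Crossing) :
    D.arcElement (D.overArc c) ◃ D.arcElement (D.rightArc c) = D.arcElement (D.leftArc c) :=
  PresentedMedialQuandle.of_act_of (.mk c)

theorem mkQ_relator (c : D.Crossing) : (LinearMap.range D.reducedRho).mkQ (D.relator c) = 0 := by
  rw [Submodule.mkQ_apply, Submodule.Quotient.mk_eq_zero]
  exact ⟨Finsupp.single c 1, by simp [reducedRho]⟩

theorem arcClass_leftArc (c : D.Crossing) :
    D.arcClass (D.leftArc c) = (1 - T 1 : ℤ[T;T⁻¹]) • D.arcClass (D.overArc c) +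
      (T 1 : ℤ[T;T⁻¹]) • D.arcClass (D.rightArc c) := by
  have h := D.mkQ_relator c
  rw [relator, map_sub, sub_eq_zero] at h
  rw [arcClass, ← h, arcClass, arcClass, ← map_smul, ← map_smul, ← map_add]
  simp

variable {D} in
theorem span_arcClass : Submodule.span ℤ[T;T⁻¹] (Set.range D.arcClass) = ⊤ := by
  have : Set.range D.arcClass =
      (LinearMap.range D.reducedRho).mkQ '' Set.range fun a => Finsupp.single a 1 := by
    rw [← Set.range_comp]
    rfl
  rw [this, ← Submodule.map_span, ← Finsupp.coe_basisSingleOne,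
    Module.Basis.span_eq]
  simp

/-- An additive subgroup of the reduced Alexander module that contains the classes of the arcs and
is closed under `t` and `t⁻¹` is everything. -/
theorem mem_of_arcClass_mem (S : AddSubgroup D.ReducedAlexanderModule)
    (harc : ∀ a, D.arcClass a ∈ S) (hT : ∀ m ∈ S, (T 1 : ℤ[T;T⁻¹]) • m ∈ S)
    (hT' : ∀ m ∈ S, (T (-1) : ℤ[T;T⁻¹]) • m ∈ S) (m : D.ReducedAlexanderModule) : m ∈ S := by
  have hm : m ∈ Submodule.span ℤ[T;T⁻¹] (Set.range D.arcClass) := by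
    rw [span_arcClass]
    trivial
  induction hm using Submodule.span_induction with
  | mem x hx =>
    obtain ⟨a, rfl⟩ := hx
    exact harc a
  | zero => exact S.zero_mem
  | add x y _ _ hx hy => exact S.add_mem hx hy
  | smul p x _ hx => exact smul_induction S hT hT' p hx

variable {D} in
theorem linearMap_ext {N : Type*} [AddCommGroup N] [Module ℤ[T;T⁻¹] N]
    {f g : D.ReducedAlexanderModule →ₗ[ℤ[T;T⁻¹]] N}
    (h : ∀ a, f (D.arcClass a) = g (D.arcClass a)) : f = g :=
  LinearMap.ext_on_range span_arcClass h

/-- A linear map on the reduced Alexander module, given by its values on the arcs. -/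
noncomputable def lift {N : Type*} [AddCommGroup N] [Module ℤ[T;T⁻¹] N] (f : D.Arc → N)
    (hf : ∀ c, f (D.leftArc c) = (1 - T 1 : ℤ[T;T⁻¹]) • f (D.overArc c) +
      (T 1 : ℤ[T;T⁻¹]) • f (D.rightArc c)) : D.ReducedAlexanderModule →ₗ[ℤ[T;T⁻¹]] N :=
  (LinearMap.range D.reducedRho).liftQ (Finsupp.linearCombination ℤ[T;T⁻¹] f) (by
    rw [LinearMap.range_le_ker_iff]
    ext c
    simp [reducedRho, relator, hf, sub_smul])

@[simp]
theorem lift_arcClass {N : Type*} [AddCommGroup N] [Module ℤ[T;T⁻¹] N] (f : D.Arc → N) (hf)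
    (a : D.Arc) : D.lift f hf (D.arcClass a) = f a := by
  simp [lift, arcClass]

@[simp]
theorem reducedCrowellMap_arcClass (a : D.Arc) : D.reducedCrowellMap (D.arcClass a) = 1 := by
  simp [reducedCrowellMap, arcClass]

/-- The map from the medial quandle to the reduced Alexander module that sends the generator of an
arc to its class. -/
noncomputable def alexanderMap : D.MedialQuandle → D.ReducedAlexanderModule :=
  Quotient.lift (QuandleWord.eval D.arcClass) fun _ _ h => MedialRel.eval_eq (by
    rintro _ _ _ ⟨c⟩
    exact D.arcClass_leftArc c) h

@[simp]
theorem alexanderMap_arcElement (a : D.Arc) : D.alexanderMap (D.arcElement a) = D.arcClass a := rfl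

theorem isAlexanderMap_alexanderMap : IsAlexanderMap D.alexanderMap := fun x y =>
  Quotient.inductionOn₂ x y fun _ _ => rfl

variable {D} in
/-- Maps from the medial quandle to modules extend to the reduced Alexander module. -/
noncomputable def extend {N : Type*} [AddCommGroup N] [Module ℤ[T;T⁻¹] N] {g : D.MedialQuandle → N}
    (hg : IsAlexanderMap g) : D.ReducedAlexanderModule →ₗ[ℤ[T;T⁻¹]] N :=
  D.lift (fun a => g (D.arcElement a)) fun c => by rw [← D.arcElement_act, hg]

@[simp]
theorem extend_alexanderMap {N : Type*} [AddCommGroup N] [Module ℤ[T;T⁻¹] N]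
    {g : D.MedialQuandle → N} (hg : IsAlexanderMap g) (x : D.MedialQuandle) :
    extend hg (D.alexanderMap x) = g x :=
  PresentedMedialQuandle.alexanderMap_ext
    (D.isAlexanderMap_alexanderMap.linearMap_comp (extend hg)) hg
    (fun a => by exact D.lift_arcClass _ _ a) x

@[simp]
theorem reducedCrowellMap_alexanderMap (x : D.MedialQuandle) :
    D.reducedCrowellMap (D.alexanderMap x) = 1 :=
  PresentedMedialQuandle.alexanderMap_ext (g' := fun _ => (1 : ℤ[T;T⁻¹]))
    (D.isAlexanderMap_alexanderMap.linearMap_comp D.reducedCrowellMap)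
    (fun x y => by simp) (fun a => D.reducedCrowellMap_arcClass a) x

/-! ### The medial quandle determines the reduced Alexander invariant -/

/-- An isomorphism of medial quandles induces an isomorphism of reduced Alexander invariants. -/
theorem nonempty_invariant_equiv {D D' : LinkDiagram} (f : D.MedialQuandle →◃ D'.MedialQuandle)
    (hf : Function.Bijective f) :
    Nonempty (D.ReducedAlexanderInvariant ≃ₗ[ℤ[T;T⁻¹]] D'.ReducedAlexanderInvariant) := by
  let e := Equiv.ofBijective f hf
  let g : D'.MedialQuandle →◃ D.MedialQuandle :=
    { toFun := e.symm
      map_act' := by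
        intro x y
        rw [Equiv.symm_apply_eq]
        change _ = f _
        rw [ShelfHom.map_act]
        congr 1
        · exact (e.apply_symm_apply x).symm
        · exact (e.apply_symm_apply y).symm }
  have hgf (x) : g (f x) = x := e.symm_apply_apply x
  have hfg (x) : f (g x) = x := e.apply_symm_apply x
  let F := extend (D'.isAlexanderMap_alexanderMap.comp_shelfHom f)
  let G := extend (D.isAlexanderMap_alexanderMap.comp_shelfHom g)
  have hF (x) : F (D.alexanderMap x) = D'.alexanderMap (f x) := D.extend_alexanderMap _ x
  have hG (x) : G (D'.alexanderMap x) = D.alexanderMap (g x) := D'.extend_alexanderMap _ x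
  let E : D.ReducedAlexanderModule ≃ₗ[ℤ[T;T⁻¹]] D'.ReducedAlexanderModule :=
    LinearEquiv.ofLinearMap F G
      (linearMap_ext fun a => by
        rw [LinearMap.comp_apply, ← alexanderMap_arcElement, hG, hF, hfg]; rfl)
      (linearMap_ext fun a => by
        rw [LinearMap.comp_apply, ← alexanderMap_arcElement, hF, hG, hgf]; rfl)
  -- Arcs go to images of quandle elements, on which the Crowell map is `1`.
  have hE : D'.reducedCrowellMap ∘ₗ E.toLinearMap = D.reducedCrowellMap :=
    linearMap_ext fun a => by
      change D'.reducedCrowellMap (F _) = _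
      rw [← alexanderMap_arcElement, hF]
      simp
  refine ⟨E.ofSubmodules _ _ ?_⟩
  rw [ReducedAlexanderInvariant, ← hE, LinearMap.ker_comp]
  exact Submodule.map_comap_eq_of_surjective E.surjective _

end LinkDiagram

/-! ### The action of the reduced Alexander module on the medial quandle -/

namespace LinkDiagram

open Rack

variable {D : LinkDiagram}

/-- The action of the reduced Alexander module on the medial quandle by displacements. -/
noncomputable def displacement (o : D.MedialQuandle) :
    D.ReducedAlexanderModule →ₗ[ℤ[T;T⁻¹]] Displacement PresentedMedialQuandle.isAbelian o :=
  extend (g := Displacement.ofElement PresentedMedialQuandle.isAbelian o)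
    (fun x y => Displacement.ofElement_act x y)

theorem displacement_alexanderMap (o x : D.MedialQuandle) :
    displacement o (D.alexanderMap x) =
      Displacement.ofElement PresentedMedialQuandle.isAbelian o x :=
  D.extend_alexanderMap _ x

/-- The permutation of the medial quandle by which an element of the reduced Alexander module
acts. -/
noncomputable def move (o : D.MedialQuandle) (m : D.ReducedAlexanderModule) :
    Equiv.Perm D.MedialQuandle :=
  (displacement o m).toPerm

variable (o : D.MedialQuandle)

@[simp]
theorem move_zero : move o 0 = 1 := by simp [move]

theorem move_add (m n : D.ReducedAlexanderModule) : move o (m + n) = move o m * move o n := by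
  simp [move]

theorem move_neg (m : D.ReducedAlexanderModule) : move o (-m) = (move o m)⁻¹ := by
  simp [move]

/-- The two contributions of the base point cancel, so the right side does not depend on `o`. -/
theorem move_sub (x y : D.MedialQuandle) :
    move o (D.alexanderMap x - D.alexanderMap y) = act' x * (act' y)⁻¹ := by
  rw [move, map_sub, displacement_alexanderMap, displacement_alexanderMap,
    Displacement.toPerm_ofElement_sub]

theorem move_sub_apply (x y z : D.MedialQuandle) :
    move o (D.alexanderMap x - D.alexanderMap y) z = x ◃ y ◃⁻¹ z := by
  rw [move_sub]
  rfl

/-- By idempotence `y = y ◃⁻¹ y`, so the action of `x` on `y` is the displacement from `y` to `x`.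
-/
theorem act_eq_move (x y : D.MedialQuandle) :
    x ◃ y = move o (D.alexanderMap x - D.alexanderMap y) y := by
  rw [move_sub_apply, Quandle.fix_inv]

theorem invAct_eq_move (x y : D.MedialQuandle) :
    x ◃⁻¹ y = move o (D.alexanderMap (x ◃⁻¹ y) - D.alexanderMap x) y := by
  have h := act_eq_move o x (x ◃⁻¹ y)
  rw [act_invAct_eq] at h
  rw [← neg_sub, move_neg, Equiv.Perm.eq_inv_iff_eq, ← h]

/-- The formula is stable under sums, negatives and `t`, `t⁻¹`, so arcs suffice. The correction by
`reducedCrowellMap m` appears because displacements are taken relative to `o`, so that the class of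
`o` acts trivially. -/
theorem alexanderMap_move (m : D.ReducedAlexanderModule) (z : D.MedialQuandle) :
    D.alexanderMap (move o m z) = D.alexanderMap z +
      (1 - T 1 : ℤ[T;T⁻¹]) • (m - D.reducedCrowellMap m • D.alexanderMap o) := by
  let S : AddSubgroup D.ReducedAlexanderModule :=
    { carrier := {m | ∀ z, D.alexanderMap (move o m z) = D.alexanderMap z +
        (1 - T 1 : ℤ[T;T⁻¹]) • (m - D.reducedCrowellMap m • D.alexanderMap o)}
      zero_mem' := fun z => by simp
      add_mem' := fun {m n} hm hn z => by
        rw [move_add, Equiv.Perm.mul_apply, hm, hn, map_add]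
        module
      neg_mem' := fun {m} hm z => by
        have h := hm (move o (-m) z)
        rw [← Equiv.Perm.mul_apply, ← move_add, add_neg_cancel, move_zero, Equiv.Perm.one_apply]
          at h
        rw [h, map_neg]
        module }
  have hinv : (T (-1) * T 1 : ℤ[T;T⁻¹]) = 1 := by rw [← T_add]; simp
  have hinv' : (T 1 * T (-1) : ℤ[T;T⁻¹]) = 1 := by rw [← T_add]; simp
  refine D.mem_of_arcClass_mem S (fun a z => ?_) (fun m hm z => ?_) (fun m hm z => ?_) m z
  · have : move o (D.arcClass a) = act' (D.arcElement a) * (act' o)⁻¹ := by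
      rw [move, ← alexanderMap_arcElement, displacement_alexanderMap]
      rfl
    rw [this, Equiv.Perm.mul_apply, invAct_apply, act'_apply,
      D.isAlexanderMap_alexanderMap.map_displacement]
    simp
  · have : move o ((T 1 : ℤ[T;T⁻¹]) • m) z = o ◃ move o m (o ◃⁻¹ z) := by
      simp [move]
    rw [this, D.isAlexanderMap_alexanderMap, hm, D.isAlexanderMap_alexanderMap.map_invAct, map_smul,
      smul_add, smul_smul (T 1), hinv']
    simp only [smul_eq_mul]
    module
  · have : move o ((T (-1) : ℤ[T;T⁻¹]) • m) z = o ◃⁻¹ move o m (o ◃ z) := by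
      simp [move]
    rw [this, D.isAlexanderMap_alexanderMap.map_invAct, hm, D.isAlexanderMap_alexanderMap, map_smul]
    have h2 : D.alexanderMap z = (T (-1) * T 1 : ℤ[T;T⁻¹]) • D.alexanderMap z := by
      rw [hinv, one_smul]
    conv_rhs => rw [h2]
    simp only [smul_eq_mul]
    module

theorem alexanderMap_move_of_mem {m : D.ReducedAlexanderModule}
    (hm : m ∈ D.ReducedAlexanderInvariant) (z : D.MedialQuandle) :
    D.alexanderMap (move o m z) = D.alexanderMap z + (1 - T 1 : ℤ[T;T⁻¹]) • m := by
  rw [alexanderMap_move, LinearMap.mem_ker.mp hm, zero_smul, sub_zero]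

theorem alexanderMap_sub_mem (x y : D.MedialQuandle) :
    D.alexanderMap x - D.alexanderMap y ∈ D.ReducedAlexanderInvariant := by
  rw [LinearMap.mem_ker, map_sub]
  simp

/-- Either operation changes its right argument only by a displacement from the kernel, so the arc
from which that argument is moved stays the same. -/
theorem exists_eq_move_arcElement (z : D.MedialQuandle) :
    ∃ a, ∃ m ∈ D.ReducedAlexanderInvariant, z = move o m (D.arcElement a) := by
  induction z using PresentedMedialQuandle.induction with
  | gen a => exact ⟨a, 0, zero_mem _, by simp; rfl⟩
  | act x y _ hy =>
    obtain ⟨a, m, hm, h⟩ := hy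
    refine ⟨a, _, add_mem (alexanderMap_sub_mem x y) hm, ?_⟩
    rw [move_add, Equiv.Perm.mul_apply, ← h, ← act_eq_move]
  | invAct x y _ hy =>
    obtain ⟨a, m, hm, h⟩ := hy
    refine ⟨a, _, add_mem (alexanderMap_sub_mem (x ◃⁻¹ y) x) hm, ?_⟩
    rw [move_add, Equiv.Perm.mul_apply, ← h, ← invAct_eq_move]

/-! ### Components -/

/-- The component that contains a passage. -/
def passageComponent (p : Passage D.Crossing) : D.Component := .inl (Quotient.mk _ p)

theorem passageComponent_eq_iff {p q : Passage D.Crossing} :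
    passageComponent p = passageComponent q ↔ D.next.SameCycle p q :=
  Sum.inl_injective.eq_iff.trans Quotient.eq

@[simp]
theorem passageComponent_next (p : Passage D.Crossing) :
    passageComponent (D.next p) = passageComponent p :=
  passageComponent_eq_iff.mpr (Equiv.Perm.sameCycle_apply_left.mpr (.refl _ _))

@[simp]
theorem passageComponent_next_symm (p : Passage D.Crossing) :
    passageComponent (D.next.symm p) = passageComponent p := by
  rw [← passageComponent_next, Equiv.apply_symm_apply]

variable (D) in
/-- The component that contains an arc. -/
def arcComponent : D.Arc → D.Component
  | .inl a => Quot.lift passageComponent (by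
      intro p q h
      cases h with
      | mk c h => rw [← h, passageComponent_next]) a
  | .inr i => .inr i

@[simp]
theorem arcComponent_arcAfter (p : Passage D.Crossing) :
    D.arcComponent (D.arcAfter p) = passageComponent p := rfl

theorem arcComponent_surjective : Function.Surjective D.arcComponent := by
  rintro (i | i)
  · induction i using Quotient.inductionOn with
    | h p => exact ⟨D.arcAfter p, rfl⟩
  · exact ⟨.inr i, rfl⟩

theorem arcComponent_rightArc (c : D.Crossing) :
    D.arcComponent (D.rightArc c) = passageComponent (.under c) := by
  unfold rightArc underIn underOut
  split <;> simp

theorem arcComponent_leftArc (c : D.Crossing) :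
    D.arcComponent (D.leftArc c) = passageComponent (.under c) := by
  unfold leftArc underIn underOut
  split <;> simp

variable (D) in
open Classical in
/-- The linear form that counts the arcs of the component `i`, at `t = 1`. -/
noncomputable def componentForm (i : D.Component) :
    D.ReducedAlexanderModule →ₗ[ℤ[T;T⁻¹]] AugmentedInt :=
  D.lift (fun a => AugmentedInt.mk (if D.arcComponent a = i then 1 else 0)) fun c =>
    AugmentedInt.equivInt.injective (by
      simp [AugmentedInt.equivInt, arcComponent_leftArc, arcComponent_rightArc])

variable (D) in
/-- The number of arcs of the component `i` in an element of the reduced Alexander module,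
at `t = 1`. -/
noncomputable def componentCount (i : D.Component) : D.ReducedAlexanderModule →+ ℤ :=
  AugmentedInt.addEquivInt.toAddMonoidHom.comp (D.componentForm i).toAddMonoidHom

open Classical in
theorem componentCount_arcClass (i : D.Component) (a : D.Arc) :
    D.componentCount i (D.arcClass a) = if D.arcComponent a = i then 1 else 0 := by
  change (D.componentForm i (D.arcClass a)).toInt = _
  rw [componentForm, lift_arcClass]

@[simp]
theorem componentCount_one_sub_T_smul (i : D.Component) (m : D.ReducedAlexanderModule) :
    D.componentCount i ((1 - T 1 : ℤ[T;T⁻¹]) • m) = 0 := by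
  change (D.componentForm i ((1 - T 1 : ℤ[T;T⁻¹]) • m)).toInt = 0
  simp

/-- The displacement between the two underpassing arcs at a crossing. -/
noncomputable def crossingShift (c : D.Crossing) : D.ReducedAlexanderModule :=
  if D.positive c then D.arcClass (D.overArc c) - D.arcClass (D.rightArc c)
  else D.arcClass (D.rightArc c) - D.arcClass (D.overArc c)

/-- The displacement of the arc along a passage. -/
noncomputable def passageShift : Passage D.Crossing → D.ReducedAlexanderModule
  | .over _ => 0
  | .under c => crossingShift c

theorem passageShift_mem (p : Passage D.Crossing) :
    passageShift p ∈ D.ReducedAlexanderInvariant := by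
  match p with
  | .over c => exact zero_mem _
  | .under c =>
    unfold passageShift crossingShift
    simp only [← alexanderMap_arcElement]
    split
    · exact alexanderMap_sub_mem _ _
    · exact alexanderMap_sub_mem _ _

/-- At an overpass the arc does not change. At an underpass the crossing relation displaces the
right arc to the left one; at a negative crossing one arrives on the left, so it is used backwards.
-/
theorem arcElement_arcAfter_next (p : Passage D.Crossing) :
    D.arcElement (D.arcAfter (D.next p)) =
      move o (passageShift (D.next p)) (D.arcElement (D.arcAfter p)) := by
  match h : D.next p with
  | .over c =>
    rw [passageShift, move_zero, Equiv.Perm.one_apply]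
    congr 1
    exact congrArg Sum.inl (Quot.sound (.mk p c h)).symm
  | .under c =>
    have hp : D.arcAfter p = D.underIn c := by rw [underIn, ← h, Equiv.symm_apply_apply]
    change D.arcElement (D.underOut c) = _
    rw [hp]
    have hact := D.arcElement_act c
    rw [act_eq_move o] at hact
    unfold passageShift crossingShift
    by_cases hc : D.positive c
    · simp only [rightArc, leftArc, hc, if_true] at hact ⊢
      exact hact.symm
    · simp only [rightArc, leftArc, hc] at hact ⊢
      simp only [Bool.false_eq_true, if_false] at hact ⊢
      rw [← neg_sub, move_neg, Equiv.Perm.eq_inv_iff_eq]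
      exact hact

theorem arcElement_arcAfter_pow (p : Passage D.Crossing) (n : ℕ) :
    D.arcElement (D.arcAfter ((D.next ^ n) p)) =
      move o (∑ i ∈ Finset.range n, passageShift ((D.next ^ (i + 1)) p))
        (D.arcElement (D.arcAfter p)) := by
  induction n with
  | zero => simp
  | succ n ih =>
    rw [pow_succ', Equiv.Perm.mul_apply, arcElement_arcAfter_next o, ih, ← Equiv.Perm.mul_apply,
      ← move_add, Finset.sum_range_succ, add_comm, pow_succ', Equiv.Perm.mul_apply]

end LinkDiagram

/-! ### Alexander numberings of classical diagrams -/

/-- The crossing of a passage. -/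
def Passage.crossing {C : Type} : Passage C → C
  | .over c => c
  | .under c => c

/-- Passages are crossings with a choice of the upper or the lower strand. -/
def Passage.equivSum (C : Type) : C ⊕ C ≃ Passage C where
  toFun := Sum.elim .over .under
  invFun
    | .over c => .inl c
    | .under c => .inr c
  left_inv := by rintro (c | c) <;> rfl
  right_inv := by rintro (c | c) <;> rfl

instance (C : Type) [Fintype C] : Fintype (Passage C) := .ofEquiv _ (Passage.equivSum C)

theorem Passage.sum_eq {C : Type} {M : Type*} [Fintype C] [AddCommMonoid M] (f : Passage C → M) :
    ∑ p, f p = ∑ c, (f (.over c) + f (.under c)) := by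
  rw [← (Passage.equivSum C).sum_comp, Fintype.sum_sum_type, Finset.sum_add_distrib]
  rfl

/-- Half-edges are passages with a choice of the entering or the leaving half. -/
def HalfEdge.equivSum (C : Type) : Passage C ⊕ Passage C ≃ HalfEdge C where
  toFun := Sum.elim .enter .leave
  invFun
    | .enter p => .inl p
    | .leave p => .inr p
  left_inv := by rintro (p | p) <;> rfl
  right_inv := by rintro (p | p) <;> rfl

instance (C : Type) [Fintype C] : Fintype (HalfEdge C) := .ofEquiv _ (HalfEdge.equivSum C)

/-! ### Cellular homology of the surface carrying the diagram, and Alexander numberings -/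

namespace LinkDiagram

variable (D : LinkDiagram)

instance : Finite D.Face := inferInstanceAs (Finite (Quotient _))

instance : Finite D.Piece := inferInstanceAs (Finite (Quotient _))

noncomputable instance : Fintype D.Face := Fintype.ofFinite _

noncomputable instance : Fintype D.Piece := Fintype.ofFinite _

/-- The face on the right of a half-edge, directed towards the other half. -/
def faceOf (x : HalfEdge D.Crossing) : D.Face := Quotient.mk _ x

/-- The piece of a half-edge. -/
def pieceOf (x : HalfEdge D.Crossing) : D.Piece := Quotient.mk _ x

/-- The permutation whose cycles are the faces sends `edgeFlip x` to `rotation x`. -/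
theorem faceOf_edgeFlip (x : HalfEdge D.Crossing) :
    D.faceOf (D.edgeFlip x) = D.faceOf (D.rotation x) := by
  refine Quotient.sound ⟨1, ?_⟩
  rw [zpow_one, Equiv.Perm.mul_apply]
  exact congrArg D.rotation (D.edgeFlip.left_inv x)

variable {D} in
theorem exists_eq_comp_pieceOf {Y : Type*} (f : HalfEdge D.Crossing → Y)
    (hrot : ∀ x, f (D.rotation x) = f x) (hflip : ∀ x, f (D.edgeFlip x) = f x) :
    ∃ g : D.Piece → Y, ∀ x, f x = g (D.pieceOf x) := by
  have key (g : Equiv.Perm (HalfEdge D.Crossing))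
      (hg : g ∈ Subgroup.closure {D.rotation, D.edgeFlip}) : ∀ x, f (g x) = f x := by
    induction hg using Subgroup.closure_induction with
    | mem g hg =>
      rcases hg with rfl | rfl
      · exact hrot
      · exact hflip
    | one => exact fun _ => rfl
    | mul g g' _ _ h h' => exact fun x => (h _).trans (h' x)
    | inv g _ h => exact fun x => (h _).symm.trans (congrArg f (g.apply_symm_apply x))
  refine ⟨Quotient.lift f ?_, fun x => rfl⟩
  rintro _ x ⟨⟨g, hg⟩, rfl⟩
  exact key g hg x

/-- The differences of a function on the faces across the edges. -/
def edgeDifference : (D.Face → ℚ) →ₗ[ℚ] (Passage D.Crossing → ℚ) where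
  toFun h p := h (D.faceOf (.leave p)) - h (D.faceOf (.enter (D.next p)))
  map_add' h h' := by
    ext p
    simp only [Pi.add_apply]
    ring
  map_smul' r h := by
    ext p
    simp only [Pi.smul_apply, smul_eq_mul, RingHom.id_apply]
    ring

/-- The excess of the outgoing over the incoming edges at a crossing. -/
def crossingExcess : (Passage D.Crossing → ℚ) →ₗ[ℚ] (D.Crossing → ℚ) where
  toFun g c := (g (.over c) - g (D.next.symm (.over c))) +
    (g (.under c) - g (D.next.symm (.under c)))
  map_add' g g' := by
    ext c
    simp only [Pi.add_apply]
    ring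
  map_smul' r g := by
    ext c
    simp only [Pi.smul_apply, smul_eq_mul, RingHom.id_apply]
    ring

theorem edgeDifference_apply (h : D.Face → ℚ) (p : Passage D.Crossing) :
    D.edgeDifference h p =
      h (D.faceOf (.leave p)) - h (D.faceOf (D.rotation (.leave p))) := by
  rw [← faceOf_edgeFlip]
  rfl

theorem edgeDifference_next_symm (h : D.Face → ℚ) (p : Passage D.Crossing) :
    D.edgeDifference h (D.next.symm p) =
      h (D.faceOf (D.rotation (.enter p))) - h (D.faceOf (.enter p)) := by
  rw [← faceOf_edgeFlip]
  change h _ - h (D.faceOf (.enter (D.next (D.next.symm p)))) = _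
  rw [Equiv.apply_symm_apply]
  rfl

/-- The excess at a crossing is the sum of `h (faceOf x) - h (faceOf (rotation x))` over its four
half-edges `x`, which `rotation` permutes. Homologically, this is `∂ ∘ ∂ = 0`. -/
theorem crossingExcess_edgeDifference (h : D.Face → ℚ) :
    D.crossingExcess (D.edgeDifference h) = 0 := by
  ext c
  change (D.edgeDifference h _ - D.edgeDifference h _) +
    (D.edgeDifference h _ - D.edgeDifference h _) = 0
  rw [edgeDifference_next_symm, edgeDifference_next_symm, edgeDifference_apply,
    edgeDifference_apply]
  cases hc : D.positive c <;> simp [rotation, ccw, hc] <;> ring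

/-- A function on faces without differences across edges is unchanged by `edgeFlip` and `rotation`,
hence constant on pieces. -/
theorem finrank_ker_edgeDifference_le :
    Module.finrank ℚ (LinearMap.ker D.edgeDifference) ≤ Nat.card D.Piece := by
  let pullback : (D.Piece → ℚ) →ₗ[ℚ] (D.Face → ℚ) :=
    LinearMap.funLeft ℚ ℚ fun x => D.pieceOf x.out
  have hle : LinearMap.ker D.edgeDifference ≤ LinearMap.range pullback := by
    intro h hh
    have hflip (x) : h (D.faceOf (D.edgeFlip x)) = h (D.faceOf x) := by
      match x with
      | .leave p =>
        exact (sub_eq_zero.mp (congrFun hh p)).symm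
      | .enter p =>
        have := congrFun hh (D.next.symm p)
        rw [edgeDifference_next_symm, ← faceOf_edgeFlip] at this
        exact sub_eq_zero.mp this
    obtain ⟨g, hg⟩ := exists_eq_comp_pieceOf (fun x => h (D.faceOf x))
      (fun x => by rw [← faceOf_edgeFlip, hflip]) hflip
    refine ⟨g, funext fun x => ?_⟩
    change g (D.pieceOf x.out) = h x
    rw [← hg]
    exact congrArg h (Quotient.out_eq x)
  refine (Submodule.finrank_mono hle).trans ((LinearMap.finrank_range_le _).trans ?_)
  rw [Module.finrank_pi, Nat.card_eq_fintype_card]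

/-- Summation by parts: the transpose of `crossingExcess` takes differences along edges. -/
theorem sum_mul_crossingExcess (y : D.Crossing → ℚ) (g : Passage D.Crossing → ℚ) :
    ∑ c, y c * D.crossingExcess g c =
      ∑ p, (y p.crossing - y (D.next p).crossing) * g p := by
  have h : ∑ p, y (D.next p).crossing * g p = ∑ p, y p.crossing * g (D.next.symm p) := by
    rw [← Equiv.sum_comp D.next (fun p => y p.crossing * g (D.next.symm p))]
    simp
  simp only [sub_mul, Finset.sum_sub_distrib]
  rw [h, ← Finset.sum_sub_distrib, Passage.sum_eq]
  refine Finset.sum_congr rfl fun c _ => ?_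
  simp only [crossingExcess, LinearMap.coe_mk, AddHom.coe_mk, Passage.crossing]
  ring

/-- A functional vanishing on the range is a function on crossings with equal values at both ends of
every edge. It factors through the pieces, which bounds the corank. -/
theorem card_crossing_le_finrank_range_crossingExcess :
    Nat.card D.Crossing ≤
      Module.finrank ℚ (LinearMap.range D.crossingExcess) + Nat.card D.Piece := by
  classical
  let Θ : (D.Piece → ℚ) →ₗ[ℚ] Module.Dual ℚ (D.Crossing → ℚ) :=
    (dotProductEquiv ℚ D.Crossing).toLinearMap ∘ₗ
      LinearMap.funLeft ℚ ℚ fun c => D.pieceOf (.leave (.over c))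
  have hle : LinearMap.ker D.crossingExcess.dualMap ≤ LinearMap.range Θ := by
    intro l hl
    obtain ⟨y, rfl⟩ := (dotProductEquiv ℚ D.Crossing).surjective l
    have hy (p) : y p.crossing = y (D.next p).crossing := by
      have h := LinearMap.congr_fun hl (Pi.single p 1)
      change y ⬝ᵥ D.crossingExcess (Pi.single p 1) = 0 at h
      rw [dotProduct, sum_mul_crossingExcess] at h
      simpa [Pi.single_apply, sub_eq_zero] using h
    let f : HalfEdge D.Crossing → ℚ
      | .leave p => y p.crossing
      | .enter p => y p.crossing
    obtain ⟨g, hg⟩ := exists_eq_comp_pieceOf f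
      (by rintro ((c | c) | (c | c)) <;> cases hc : D.positive c <;>
            simp [rotation, ccw, hc, f, Passage.crossing])
      (by
        rintro (p | p)
        · change y (D.next.symm p).crossing = y p.crossing
          rw [hy, Equiv.apply_symm_apply]
        · exact (hy p).symm)
    refine ⟨g, ?_⟩
    change dotProductEquiv ℚ D.Crossing _ = _
    congr 1
    ext c
    exact (hg _).symm
  have h₁ := LinearMap.finrank_range_add_finrank_ker D.crossingExcess.dualMap
  rw [LinearMap.finrank_range_dualMap_eq_finrank_range, Subspace.dual_finrank_eq,
    Module.finrank_pi, ← Nat.card_eq_fintype_card] at h₁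
  have h₂ := (Submodule.finrank_mono hle).trans (LinearMap.finrank_range_le _)
  rw [Module.finrank_pi, ← Nat.card_eq_fintype_card] at h₂
  omega

variable {D} in
-- Exactness at the edges: the first rational homology vanishes. The range has dimension at least `F
-- - k`, the kernel at most `E - V + k`, and Euler's formula makes these bounds equal.
theorem IsClassical.range_edgeDifference (hD : D.IsClassical) :
    LinearMap.range D.edgeDifference = LinearMap.ker D.crossingExcess := by
  refine Submodule.eq_of_le_of_finrank_le ?_ ?_
  · rintro _ ⟨h, rfl⟩
    exact D.crossingExcess_edgeDifference h
  · have h₁ := LinearMap.finrank_range_add_finrank_ker D.edgeDifference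
    have h₂ := LinearMap.finrank_range_add_finrank_ker D.crossingExcess
    rw [Module.finrank_pi, ← Nat.card_eq_fintype_card] at h₁ h₂
    have h₃ := D.finrank_ker_edgeDifference_le
    have h₄ := D.card_crossing_le_finrank_range_crossingExcess
    unfold IsClassical at hD
    omega

variable {D} in
/-- A classical diagram has a numbering of its faces that increases by one across every edge from
the left to the right. -/
theorem IsClassical.exists_face_numbering (hD : D.IsClassical) :
    ∃ h : D.Face → ℤ, ∀ p, h (D.faceOf (.leave p)) = h (D.faceOf (.enter (D.next p))) + 1 := by
  -- Two edges enter and two edges leave every crossing.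
  have h1 : (fun _ => 1) ∈ LinearMap.ker D.crossingExcess := by
    rw [LinearMap.mem_ker]
    ext c
    simp [crossingExcess]
  rw [← hD.range_edgeDifference] at h1
  obtain ⟨h, hh⟩ := h1
  -- The solution is only rational, but its differences are exactly 1 and survive rounding down.
  refine ⟨fun x => ⌊h x⌋, fun p => ?_⟩
  have : h (D.faceOf (.leave p)) = h (D.faceOf (.enter (D.next p))) + 1 := by
    have := congrFun hh p
    simp only [edgeDifference, LinearMap.coe_mk, AddHom.coe_mk] at this
    linarith
  simp only [this, Int.floor_add_one]

/-- The defining property of a numbering of the edges by the index of the face on their right. -/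
def IsAlexanderNumbering (κ : Passage D.Crossing → ℤ) : Prop :=
  ∀ c, if D.positive c then
      κ (.over c) = κ (.under c) + 1 ∧ κ (D.next.symm (.over c)) = κ (.under c) ∧
        κ (D.next.symm (.under c)) = κ (.under c) + 1
    else
      κ (.under c) = κ (.over c) + 1 ∧ κ (D.next.symm (.over c)) = κ (.over c) + 1 ∧
        κ (D.next.symm (.under c)) = κ (.over c)

variable {D} in
-- Each edge gets the number of the face on its right. Neighbouring edges at a crossing share the
-- face in the corner between them, which relates their numbers.
theorem IsClassical.exists_isAlexanderNumbering (hD : D.IsClassical) :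
    ∃ κ, D.IsAlexanderNumbering κ := by
  obtain ⟨h, hh⟩ := hD.exists_face_numbering
  have hleave (p) : h (D.faceOf (.leave p)) = h (D.faceOf (D.rotation (.leave p))) + 1 := by
    rw [← faceOf_edgeFlip]
    exact hh p
  have henter (p) : h (D.faceOf (.leave (D.next.symm p))) =
      h (D.faceOf (D.rotation (.enter p))) := by
    rw [← faceOf_edgeFlip]
    rfl
  have henter' (p) : h (D.faceOf (.leave (D.next.symm p))) = h (D.faceOf (.enter p)) + 1 := by
    rw [hh, Equiv.apply_symm_apply]
  refine ⟨fun p => h (D.faceOf (.leave p)), fun c => ?_⟩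
  have h₁ := hleave (.over c)
  have h₂ := hleave (.under c)
  have h₃ := henter (.over c)
  have h₄ := henter (.under c)
  have h₅ := henter' (.over c)
  have h₆ := henter' (.under c)
  cases hc : D.positive c
  · simp only [rotation, ccw, hc, Equiv.coe_fn_mk, Bool.false_eq_true, if_false] at *
    omega
  · simp only [rotation, ccw, hc, Equiv.coe_fn_mk, if_true] at *
    omega

end LinkDiagram

/-! ### Longitudes -/

namespace LinkDiagram

variable {D : LinkDiagram}

/-- The sign of a crossing. -/
def crossingSign (c : D.Crossing) : ℤ := if D.positive c then 1 else -1

theorem crossingSign_mul_self (c : D.Crossing) : crossingSign c * crossingSign c = 1 := by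
  unfold crossingSign
  split <;> simp

theorem crossingShift_eq (c : D.Crossing) : crossingShift c =
    crossingSign c • (D.arcClass (D.overArc c) - D.arcClass (D.rightArc c)) := by
  unfold crossingShift crossingSign
  split <;> simp

theorem arcAfter_next_symm_over (c : D.Crossing) :
    D.arcAfter (D.next.symm (.over c)) = D.overArc c :=
  congrArg Sum.inl (Quot.sound (.mk _ c (by simp)))

theorem sum_passage_telescope {M : Type*} [AddCommGroup M] (f : Passage D.Crossing → M) :
    ∑ c, ((f (D.next.symm (.over c)) - f (.over c)) +
      (f (D.next.symm (.under c)) - f (.under c))) = 0 := by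
  rw [← Passage.sum_eq fun p => f (D.next.symm p) - f p, Finset.sum_sub_distrib,
    Equiv.sum_comp D.next.symm f, sub_self]

/-- Separates a multiple of `1 - t`, whose cofactor is the displacement at the crossing up to sign,
from the part that survives at `t = 1`. -/
theorem relator_eq (c : D.Crossing) : D.relator c =
    (1 - T 1 : ℤ[T;T⁻¹]) • (Finsupp.single (D.overArc c) 1 - Finsupp.single (D.rightArc c) 1) +
      (Finsupp.single (D.rightArc c) 1 - Finsupp.single (D.leftArc c) 1) := by
  have h (a : D.Arc) (p : ℤ[T;T⁻¹]) : Finsupp.single a p = p • Finsupp.single a 1 := by simp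
  rw [relator, h _ (1 - T 1), h _ (T 1)]
  module

theorem single_rightArc_sub_leftArc {R : Type*} [Ring R] (c : D.Crossing) :
    (Finsupp.single (D.rightArc c) (1 : R) - Finsupp.single (D.leftArc c) 1) =
      crossingSign c •
        (Finsupp.single (D.underIn c) (1 : R) - Finsupp.single (D.underOut c) 1) := by
  unfold rightArc leftArc crossingSign
  split <;> simp

theorem one_sub_T_smul_injective :
    Function.Injective fun x : D.Arc →₀ ℤ[T;T⁻¹] => (1 - T 1 : ℤ[T;T⁻¹]) • x :=
  smul_right_injective _ one_sub_T_ne_zero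

theorem sum_smul_relator_mem (v : D.Crossing → ℤ[T;T⁻¹]) :
    ∑ c, v c • D.relator c ∈ LinearMap.range D.reducedRho :=
  sum_mem fun c _ => Submodule.smul_mem _ _ ⟨Finsupp.single c 1, by simp [reducedRho]⟩

theorem mkQ_sum_zsmul (n : D.Crossing → ℤ) :
    (LinearMap.range D.reducedRho).mkQ (∑ c, n c •
      (Finsupp.single (D.overArc c) 1 - Finsupp.single (D.rightArc c) 1)) =
      ∑ c, n c • (D.arcClass (D.overArc c) - D.arcClass (D.rightArc c)) := by
  simp only [map_sum, map_zsmul, map_sub]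
  rfl

/-- The relation between the crossing relators given by an Alexander numbering. -/
theorem IsAlexanderNumbering.sum_relator {κ : Passage D.Crossing → ℤ}
    (hκ : D.IsAlexanderNumbering κ) :
    ∃ k : D.Crossing → ℤ, ∑ c, ((crossingSign c : ℤ[T;T⁻¹]) * T (k c)) • D.relator c = 0 := by
  -- The exponent is the smaller of the two numbers on the edges at `c`. The scaled relator is then
  -- the incoming minus the outgoing terms `t ^ κ`, which telescope.
  refine ⟨fun c => if D.positive c then κ (.under c) else κ (.over c), ?_⟩
  rw [← D.sum_passage_telescope fun p => Finsupp.single (D.arcAfter p) (T (κ p) : ℤ[T;T⁻¹])]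
  refine Finset.sum_congr rfl fun c _ => ?_
  have h := hκ c
  rw [arcAfter_next_symm_over, relator]
  change _ = _ - Finsupp.single (D.overArc c) _ +
    (Finsupp.single (D.underIn c) _ - Finsupp.single (D.underOut c) _)
  unfold rightArc leftArc crossingSign
  have hsingle (a : D.Arc) (p : ℤ[T;T⁻¹]) : Finsupp.single a p = p • Finsupp.single a 1 := by simp
  cases hc : D.positive c
  · simp only [hc, Bool.false_eq_true, if_false] at h ⊢
    obtain ⟨h₁, h₂, h₃⟩ := h
    rw [h₁, h₂, h₃]
    simp only [hsingle _ (T _), hsingle _ (T _ * T _), hsingle _ (1 - T _), T_add,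
      Int.cast_neg, Int.cast_one]
    module
  · simp only [hc, if_true] at h ⊢
    obtain ⟨h₁, h₂, h₃⟩ := h
    rw [h₁, h₂, h₃]
    simp only [hsingle _ (T _), hsingle _ (T _ * T _), hsingle _ (1 - T _), T_add,
      Int.cast_one]
    module

/-- The sum of all longitudes of a classical link vanishes. -/
theorem IsClassical.sum_crossingShift (hD : D.IsClassical) :
    ∑ c : D.Crossing, crossingShift c = 0 := by
  obtain ⟨κ, hκ⟩ := hD.exists_isAlexanderNumbering
  obtain ⟨k, hk⟩ := hκ.sum_relator
  -- Subtracting `hk` from the signed sum of relators leaves coefficients `±(1 - t ^ k)`. Dividing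
  -- by `1 - t` in the free module writes the total longitude in terms of relators.
  choose d hd using fun c => one_sub_T_dvd_one_sub_T (k c)
  have htel : ∑ c : D.Crossing, crossingSign c •
      (Finsupp.single (D.rightArc c) (1 : ℤ[T;T⁻¹]) - Finsupp.single (D.leftArc c) 1) = 0 := by
    rw [← D.sum_passage_telescope fun p => Finsupp.single (D.arcAfter p) (1 : ℤ[T;T⁻¹])]
    refine Finset.sum_congr rfl fun c _ => ?_
    rw [single_rightArc_sub_leftArc, smul_smul, crossingSign_mul_self, one_smul,
      arcAfter_next_symm_over, overArc, sub_self, zero_add]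
    rfl
  have key : ∑ c, crossingSign c •
      (Finsupp.single (D.overArc c) 1 - Finsupp.single (D.rightArc c) 1) =
      ∑ c, ((crossingSign c : ℤ[T;T⁻¹]) * d c) • D.relator c := by
    apply one_sub_T_smul_injective
    simp only [Finset.smul_sum]
    rw [← add_zero (∑ c, _), ← htel, ← Finset.sum_add_distrib, ← sub_eq_zero,
      ← Finset.sum_sub_distrib, ← hk]
    refine Finset.sum_congr rfl fun c _ => ?_
    have h1 : (1 - T 1 : ℤ[T;T⁻¹]) • crossingSign c •
        (Finsupp.single (D.overArc c) (1 : ℤ[T;T⁻¹]) - Finsupp.single (D.rightArc c) 1) +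
        crossingSign c •
          (Finsupp.single (D.rightArc c) (1 : ℤ[T;T⁻¹]) - Finsupp.single (D.leftArc c) 1) =
        (crossingSign c : ℤ[T;T⁻¹]) • D.relator c := by
      rw [relator_eq, Int.cast_smul_eq_zsmul]
      module
    rw [h1, smul_smul, ← sub_smul]
    congr 1
    linear_combination (crossingSign c : ℤ[T;T⁻¹]) * hd c
  simp only [crossingShift_eq]
  rw [← mkQ_sum_zsmul, key, Submodule.mkQ_apply, Submodule.Quotient.mk_eq_zero]
  exact sum_smul_relator_mem _

/-- An integral dependence between the differences of the underpassing arcs extends to a function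
that is constant along the components. -/
theorem exists_invariant_extension (n : D.Crossing → ℤ)
    (h : ∑ c, n c • (Finsupp.single (D.underIn c) (1 : ℤ) - Finsupp.single (D.underOut c) 1) = 0) :
    ∃ ν : Passage D.Crossing → ℤ, (∀ p, ν (D.next p) = ν p) ∧ ∀ c, ν (.under c) = n c := by
  classical
  -- Passages stand for edges, and `H` identifies the two edges of the upper strand at each
  -- crossing, so that the quotient receives the arcs. Free circles go to zero.
  let r : D.Crossing → (Passage D.Crossing →₀ ℤ) := fun c =>
    Finsupp.single (D.next.symm (.over c)) 1 - Finsupp.single (.over c) 1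
  let H := LinearMap.range (Finsupp.linearCombination ℤ r)
  let π : D.Arc → (Passage D.Crossing →₀ ℤ) ⧸ H :=
    Sum.elim (Quot.lift (fun p => H.mkQ (Finsupp.single p 1)) (by
      intro p q hpq
      cases hpq with
      | mk c hc =>
        rw [← sub_eq_zero, ← map_sub, Submodule.mkQ_apply, Submodule.Quotient.mk_eq_zero]
        refine ⟨Finsupp.single c 1, ?_⟩
        simp [r, ← hc])) fun _ => 0
  have h' := congrArg (Finsupp.linearCombination ℤ π) h
  simp only [map_sum, map_zsmul, map_sub, map_zero, Finsupp.linearCombination_single, one_smul] at h'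
  have hπ (p : Passage D.Crossing) : π (D.arcAfter p) = H.mkQ (Finsupp.single p 1) := rfl
  simp only [underIn, underOut, hπ, ← map_sub, ← map_zsmul, ← map_sum] at h'
  rw [Submodule.mkQ_apply, Submodule.Quotient.mk_eq_zero] at h'
  obtain ⟨w, hw⟩ := h'
  -- The overpass values lift the dependence between arcs to one between edges, in which the
  -- coefficient of `p` is `ν (next p) - ν p`.
  let ν : Passage D.Crossing → ℤ
    | .over c => -w c
    | .under c => n c
  refine ⟨ν, fun p => ?_, fun c => rfl⟩
  have hν : ∑ q, ν q • (Finsupp.single (D.next.symm q) (1 : ℤ) - Finsupp.single q 1) = 0 := by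
    rw [Passage.sum_eq, Finset.sum_add_distrib]
    change ∑ c, -w c • r c + _ = 0
    rw [Finsupp.linearCombination_apply, Finsupp.sum_fintype _ _ (by simp)] at hw
    simp only [neg_smul, Finset.sum_neg_distrib]
    rw [hw]
    exact neg_add_cancel _
  have hp := DFunLike.congr_fun hν p
  simp only [Finsupp.coe_finsetSum, Finset.sum_apply, Finsupp.smul_apply, Finsupp.coe_sub,
    Pi.sub_apply, Finsupp.single_apply, Finsupp.coe_zero, Pi.zero_apply, smul_sub,
    Finset.sum_sub_distrib, smul_eq_mul, mul_ite, mul_one, mul_zero, Equiv.symm_apply_eq,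
    Finset.sum_ite_eq', Finset.mem_univ, if_true] at hp
  exact sub_eq_zero.mp hp

/-- The elements of the reduced Alexander module that are killed by `1 - t` are the integral
combinations of the longitudes of the components. -/
theorem exists_eq_sum_passageShift {s : D.ReducedAlexanderModule}
    (hs : (1 - T 1 : ℤ[T;T⁻¹]) • s = 0) :
    ∃ ν : Passage D.Crossing → ℤ, (∀ p, ν (D.next p) = ν p) ∧ s = ∑ p, ν p • passageShift p := by
  classical
  obtain ⟨x, rfl⟩ := Submodule.mkQ_surjective _ s
  rw [← map_smul, Submodule.mkQ_apply, Submodule.Quotient.mk_eq_zero] at hs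
  obtain ⟨v, hv⟩ := hs
  rw [reducedRho, Finsupp.linearCombination_apply, Finsupp.sum_fintype _ _ (by simp)] at hv
  let n : D.Crossing → ℤ := fun c => augmentation (v c)
  -- The values `n` at `t = 1` give an integral dependence between underpassing arcs. Once it is
  -- removed, all of `hv` is divisible by `1 - t`.
  choose w hw using fun c => exists_eq_C_augmentation_add (v c)
  have hn : ∑ c, n c •
      (Finsupp.single (D.rightArc c) (1 : ℤ) - Finsupp.single (D.leftArc c) 1) = 0 := by
    have h := congrArg (Finsupp.mapRange.addMonoidHom augmentation.toAddMonoidHom) hv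
    have h0 : Finsupp.mapRange.addMonoidHom (ι := D.Arc) augmentation.toAddMonoidHom
        ((1 - T 1 : ℤ[T;T⁻¹]) • x) = 0 := by
      ext a
      simp
    rw [h0, map_sum] at h
    rw [← h]
    refine Finset.sum_congr rfl fun c _ => ?_
    ext a
    simp [relator, n, Finsupp.single_apply, apply_ite augmentation]
  have hn' : ∑ c, n c •
      (Finsupp.single (D.rightArc c) (1 : ℤ[T;T⁻¹]) - Finsupp.single (D.leftArc c) 1) = 0 := by
    have h := congrArg
      (Finsupp.mapRange.addMonoidHom (Int.castRingHom ℤ[T;T⁻¹]).toAddMonoidHom) hn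
    simp only [map_sum, map_zsmul, map_sub, map_zero] at h
    simpa using h
  have hx : x = ∑ c, w c • D.relator c + ∑ c, n c •
      (Finsupp.single (D.overArc c) 1 - Finsupp.single (D.rightArc c) 1) := by
    apply one_sub_T_smul_injective
    simp only [smul_add, Finset.smul_sum]
    rw [← hv, ← Finset.sum_add_distrib, ← add_zero (∑ c, (_ + _)), ← hn',
      ← Finset.sum_add_distrib]
    refine Finset.sum_congr rfl fun c _ => ?_
    conv_lhs => rw [hw c, eq_intCast (C : ℤ →+* ℤ[T;T⁻¹]), add_smul, Int.cast_smul_eq_zsmul]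
    rw [mul_smul, add_assoc, add_comm]
    congr 1
    rw [relator_eq]
    module
  -- The sign turns right minus left into incoming minus outgoing, and cancels against the sign in
  -- `crossingShift_eq`.
  obtain ⟨ν, hν, hνn⟩ := exists_invariant_extension (fun c => n c * crossingSign c) (by
    rw [← hn]
    refine Finset.sum_congr rfl fun c _ => ?_
    rw [single_rightArc_sub_leftArc, smul_smul])
  refine ⟨ν, hν, ?_⟩
  rw [Passage.sum_eq]
  simp only [passageShift, smul_zero, zero_add, hνn, crossingShift_eq, smul_smul, mul_assoc,
    crossingSign_mul_self, mul_one]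
  rw [← mkQ_sum_zsmul, hx, map_add, add_eq_right, Submodule.mkQ_apply,
    Submodule.Quotient.mk_eq_zero]
  exact sum_smul_relator_mem w

end LinkDiagram

/-! ### The medial quandle of a classical link with two components -/

namespace LinkDiagram

variable {D : LinkDiagram} (o : D.MedialQuandle)

open Classical in
/-- The longitude of a component fixes the arcs of the component. -/
theorem move_longitude (p : Passage D.Crossing) :
    move o (∑ q with D.next.SameCycle p q, passageShift q) (D.arcElement (D.arcAfter p)) =
      D.arcElement (D.arcAfter p) := by
  let N := Function.minimalPeriod D.next p
  have hper (x) : x ∈ Function.periodicPts D.next :=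
    D.next.injective.mem_periodicPts x
  have hN : 0 < N := Function.minimalPeriod_pos_of_mem_periodicPts (hper p)
  have hpN : (D.next ^ N) p = p := by
    rw [← Equiv.Perm.iterate_eq_pow]
    exact Function.iterate_minimalPeriod
  have h := arcElement_arcAfter_pow o p N
  rw [hpN] at h
  conv_rhs => rw [h]
  congr 2
  -- The walk collects the shifts from `next p` up to the return to `p`; over a full period the
  -- starting point is immaterial.
  have hshift : ∑ i ∈ Finset.range N, passageShift ((D.next ^ (i + 1)) p) =
      ∑ i ∈ Finset.range N, passageShift ((D.next ^ i) p) := by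
    have h₁ := Finset.sum_range_succ (fun i => passageShift ((D.next ^ i) p)) N
    rw [Finset.sum_range_succ', hpN, pow_zero, Equiv.Perm.one_apply] at h₁
    exact add_right_cancel h₁
  rw [hshift]
  symm
  refine Finset.sum_nbij (fun i => (D.next ^ i) p) ?_ ?_ ?_ fun _ _ => rfl
  · intro i _
    simp only [Finset.mem_filter, Finset.mem_univ, true_and]
    exact ⟨i, by simp⟩
  · intro i hi j hj hij
    simp only [← Equiv.Perm.iterate_eq_pow] at hij
    exact Function.iterate_injOn_Iio_minimalPeriod (by simpa using hi) (by simpa using hj) hij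
  · intro q hq
    simp only [Finset.coe_filter, Finset.mem_univ, true_and, Set.mem_ofPred_eq] at hq
    obtain ⟨k, hk⟩ := hq.exists_nat_pow_eq
    refine ⟨k % N, by simpa using Nat.mod_lt k hN, ?_⟩
    change (D.next ^ (k % N)) p = q
    rw [← hk, ← Equiv.Perm.iterate_eq_pow, ← Equiv.Perm.iterate_eq_pow,
      Function.iterate_mod_minimalPeriod_eq]

theorem move_zsmul (n : ℤ) (m : D.ReducedAlexanderModule) : move o (n • m) = move o m ^ n := by
  induction n using Int.induction_on with
  | zero => simp
  | succ n ih => rw [add_smul, move_add, ih, zpow_add_one, one_smul]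
  | pred n ih => rw [sub_smul, sub_eq_add_neg, move_add, ih, zpow_sub_one, one_smul, move_neg]

theorem eq_of_ne_of_ne (hμ : Nat.card D.Component = 2) {i j k : D.Component} (hj : j ≠ i)
    (hk : k ≠ i) : j = k := by
  obtain ⟨x, y, _, h⟩ := Nat.card_eq_two_iff.mp hμ
  have hall (z : D.Component) : z = x ∨ z = y := by
    have : z ∈ ({x, y} : Set D.Component) := h ▸ Set.mem_univ z
    simpa using this
  rcases hall i with rfl | rfl <;> rcases hall j with rfl | rfl <;> rcases hall k with rfl | rfl <;>
    simp_all

/-- For a classical link with two components, the elements of the reduced Alexander module that are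
killed by `1 - t` act trivially on the medial quandle. -/
theorem IsClassical.move_arcElement_of_one_sub_T_smul_eq_zero (hD : D.IsClassical)
    (hμ : Nat.card D.Component = 2) {s : D.ReducedAlexanderModule}
    (hs : (1 - T 1 : ℤ[T;T⁻¹]) • s = 0) (a : D.Arc) :
    move o s (D.arcElement a) = D.arcElement a := by
  classical
  obtain ⟨ν, hν, rfl⟩ := exists_eq_sum_passageShift hs
  have hsum : ∑ p : Passage D.Crossing, passageShift p = 0 := by
    rw [Passage.sum_eq]
    simpa [passageShift] using hD.sum_crossingShift
  have hcycle {p q : Passage D.Crossing} (h : D.next.SameCycle p q) : ν q = ν p := by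
    obtain ⟨k, rfl⟩ := h.exists_nat_pow_eq
    clear h
    induction k with
    | zero => rfl
    | succ k ih => rw [pow_succ', Equiv.Perm.mul_apply, hν, ih]
  -- `k` is the value of `ν` on the other component, or `0` if that has no passages. Subtracting `k`
  -- times the vanishing total longitude leaves a multiple of the longitude of the component of `a`.
  obtain ⟨k, hk⟩ : ∃ k, ∀ p, passageComponent p ≠ D.arcComponent a → ν p = k := by
    by_cases h : ∃ p, passageComponent p ≠ D.arcComponent a
    · obtain ⟨p, hp⟩ := h
      exact ⟨ν p, fun q hq => hcycle (passageComponent_eq_iff.mp (eq_of_ne_of_ne hμ hp hq))⟩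
    · push Not at h
      exact ⟨0, fun p hp => absurd (h p) hp⟩
  have hs' : ∑ p, ν p • passageShift p = ∑ p, (ν p - k) • passageShift p := by
    simp only [sub_smul, Finset.sum_sub_distrib, ← Finset.smul_sum, hsum, smul_zero, sub_zero]
  rw [hs']
  match a with
  | .inr i =>
    -- A free circle has no passages, so all of them lie on the other component.
    have hzero : ∑ p, (ν p - k) • passageShift p = 0 :=
      Finset.sum_eq_zero fun p _ => by
        rw [hk p Sum.inl_ne_inr, sub_self, zero_smul]
    rw [hzero]
    simp
  | .inl b =>
    induction b using Quot.ind with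
    | mk p =>
      have hlong : ∑ q, (ν q - k) • passageShift q =
          (ν p - k) • ∑ q with D.next.SameCycle p q, passageShift q := by
        rw [Finset.smul_sum, Finset.sum_filter]
        refine Finset.sum_congr rfl fun q _ => ?_
        split_ifs with h
        · rw [hcycle h]
        · rw [hk q fun h' => h (passageComponent_eq_iff.mp h'.symm), sub_self, zero_smul]
      rw [hlong, move_zsmul]
      exact (Equiv.Perm.zpow_apply_eq_self_of_apply_eq_self (move_longitude o p) _)

/-- Following the component from one arc to the other adds up the shifts at the passages. -/
theorem exists_move_of_arcComponent_eq {a b : D.Arc} (h : D.arcComponent a = D.arcComponent b) :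
    ∃ m ∈ D.ReducedAlexanderInvariant, D.arcElement b = move o m (D.arcElement a) := by
  match a, b with
  | .inr i, .inr j =>
    obtain rfl : i = j := Sum.inr_injective h
    exact ⟨0, zero_mem _, by simp⟩
  | .inl a, .inr j =>
    induction a using Quot.ind with
    | mk p => exact absurd h Sum.inl_ne_inr
  | .inr j, .inl a =>
    induction a using Quot.ind with
    | mk p => exact absurd h Sum.inr_ne_inl
  | .inl a, .inl b =>
    induction a using Quot.ind with
    | mk p =>
      induction b using Quot.ind with
      | mk q =>
        obtain ⟨k, rfl⟩ := (passageComponent_eq_iff.mp h).exists_nat_pow_eq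
        exact ⟨_, sum_mem fun i _ => passageShift_mem _, arcElement_arcAfter_pow o p k⟩

/-- The medial quandle of a classical link with two components embeds in the reduced Alexander
module. -/
theorem IsClassical.alexanderMap_injective (hD : D.IsClassical)
    (hμ : Nat.card D.Component = 2) : Function.Injective D.alexanderMap := by
  classical
  intro x y hxy
  obtain ⟨a, m, hm, hx⟩ := exists_eq_move_arcElement x x
  obtain ⟨b, n, hn, hy⟩ := exists_eq_move_arcElement x y
  have hxy' := hxy
  rw [hx, hy, alexanderMap_move_of_mem x hm, alexanderMap_move_of_mem x hn,
    alexanderMap_arcElement, alexanderMap_arcElement] at hxy'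
  -- Counting arcs at `t = 1` ignores multiples of `1 - t` and detects the component.
  have hab : D.arcComponent a = D.arcComponent b := by
    have h := congrArg (D.componentCount (D.arcComponent b)) hxy'
    rw [map_add, map_add, componentCount_one_sub_T_smul, componentCount_one_sub_T_smul,
      componentCount_arcClass, componentCount_arcClass, if_pos rfl] at h
    by_contra hne
    simp [hne] at h
  obtain ⟨l, hl, hb⟩ := exists_move_of_arcComponent_eq x hab
  rw [hb, ← Equiv.Perm.mul_apply, ← move_add] at hy
  -- Both elements are now moved from the same arc, so equal images force the difference of the two
  -- movements to be killed by `1 - t`.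
  have h₁ : (1 - T 1 : ℤ[T;T⁻¹]) • (m - (n + l)) = 0 := by
    have h := hxy
    conv_lhs at h => rw [hx]
    conv_rhs at h => rw [hy]
    rw [alexanderMap_move_of_mem x hm, alexanderMap_move_of_mem x (add_mem hn hl)] at h
    rw [smul_sub, add_left_cancel h, sub_self]
  have h₂ := hD.move_arcElement_of_one_sub_T_smul_eq_zero x hμ h₁ a
  have h₃ : m = (n + l) + (m - (n + l)) := by abel
  calc x = move x m (D.arcElement a) := hx
    _ = move x (n + l) (D.arcElement a) := by
      conv_lhs => rw [h₃, move_add, Equiv.Perm.mul_apply, h₂]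
    _ = y := hy.symm

/-- The image of the medial quandle in the reduced Alexander module. -/
theorem mem_range_alexanderMap_iff (x : D.ReducedAlexanderModule) :
    x ∈ Set.range D.alexanderMap ↔
      ∃ a, ∃ m ∈ D.ReducedAlexanderInvariant, x = D.arcClass a + (1 - T 1 : ℤ[T;T⁻¹]) • m := by
  constructor
  · rintro ⟨z, rfl⟩
    obtain ⟨a, m, hm, hz⟩ := exists_eq_move_arcElement z z
    refine ⟨a, m, hm, ?_⟩
    conv_lhs => rw [hz]
    exact alexanderMap_move_of_mem z hm _
  · rintro ⟨a, m, hm, rfl⟩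
    exact ⟨move (D.arcElement a) m (D.arcElement a), alexanderMap_move_of_mem _ hm _⟩

theorem exists_arcClass_eq {a b : D.Arc} (h : D.arcComponent a = D.arcComponent b) :
    ∃ m ∈ D.ReducedAlexanderInvariant,
      D.arcClass b = D.arcClass a + (1 - T 1 : ℤ[T;T⁻¹]) • m := by
  obtain ⟨m, hm, hb⟩ := exists_move_of_arcComponent_eq (D.arcElement a) h
  refine ⟨m, hm, ?_⟩
  rw [← alexanderMap_arcElement, hb, alexanderMap_move_of_mem _ hm, alexanderMap_arcElement]

/-- Two arcs that represent the two components of a link. -/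
structure ArcPair (D : LinkDiagram) where
  fst : D.Arc
  snd : D.Arc
  ne : D.arcComponent fst ≠ D.arcComponent snd
  eq_or_eq : ∀ a, D.arcComponent fst = D.arcComponent a ∨ D.arcComponent snd = D.arcComponent a

theorem nonempty_arcPair (hμ : Nat.card D.Component = 2) : Nonempty D.ArcPair := by
  obtain ⟨i, j, hij, _⟩ := Nat.card_eq_two_iff.mp hμ
  obtain ⟨a, rfl⟩ := arcComponent_surjective i
  obtain ⟨b, rfl⟩ := arcComponent_surjective j
  refine ⟨⟨a, b, hij, fun c => ?_⟩⟩
  by_cases h : D.arcComponent a = D.arcComponent c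
  · exact .inl h
  · exact .inr (eq_of_ne_of_ne hμ (Ne.symm hij) (Ne.symm h))

namespace ArcPair

variable (P : D.ArcPair)

/-- The difference of the classes of the two arcs. -/
noncomputable def difference : D.ReducedAlexanderInvariant :=
  ⟨D.arcClass P.fst - D.arcClass P.snd, by
    rw [LinearMap.mem_ker, map_sub, reducedCrowellMap_arcClass, reducedCrowellMap_arcClass,
      sub_self]⟩

/-- As the count vanishes on multiples of `1 - t`, the difference has infinite order modulo `1 - t`.
-/
theorem componentCount_difference :
    D.componentCount (D.arcComponent P.fst) P.difference = 1 := by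
  classical
  rw [difference, map_sub, componentCount_arcClass, componentCount_arcClass, if_pos rfl,
    if_neg P.ne.symm, sub_zero]

/-- Modulo `1 - t` the scalar `t` acts trivially and arcs of one component agree. -/
theorem exists_eq_zsmul_add (m : D.ReducedAlexanderModule) :
    ∃ k l : ℤ, ∃ n : D.ReducedAlexanderModule,
      m = k • D.arcClass P.fst + l • D.arcClass P.snd + (1 - T 1 : ℤ[T;T⁻¹]) • n := by
  let S : AddSubgroup D.ReducedAlexanderModule :=
    { carrier := {m | ∃ k l : ℤ, ∃ n : D.ReducedAlexanderModule,
        m = k • D.arcClass P.fst + l • D.arcClass P.snd + (1 - T 1 : ℤ[T;T⁻¹]) • n}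
      zero_mem' := ⟨0, 0, 0, by simp⟩
      add_mem' := by
        rintro _ _ ⟨k, l, n, rfl⟩ ⟨k', l', n', rfl⟩
        exact ⟨k + k', l + l', n + n', by module⟩
      neg_mem' := by
        rintro _ ⟨k, l, n, rfl⟩
        exact ⟨-k, -l, -n, by module⟩ }
  refine D.mem_of_arcClass_mem S (fun a => ?_) ?_ ?_ m
  · rcases P.eq_or_eq a with h | h
    · obtain ⟨n, _, hn⟩ := exists_arcClass_eq h
      exact ⟨1, 0, n, by rw [hn]; module⟩
    · obtain ⟨n, _, hn⟩ := exists_arcClass_eq h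
      exact ⟨0, 1, n, by rw [hn]; module⟩
  · rintro m ⟨k, l, n, hm⟩
    exact ⟨k, l, n - m, by linear_combination (norm := module) hm⟩
  · rintro m ⟨k, l, n, hm⟩
    have hT : (T (-1) : ℤ[T;T⁻¹]) • m = m + (1 - T 1 : ℤ[T;T⁻¹]) • (T (-1) : ℤ[T;T⁻¹]) • m := by
      rw [smul_smul, sub_mul, one_mul, ← T_add, sub_smul]
      simp
    exact ⟨k, l, n + (T (-1) : ℤ[T;T⁻¹]) • m, by
      linear_combination (norm := module) hT + hm⟩

/-- The Crowell map at `t = 1` gives `k + l = 0` in `exists_eq_zsmul_add`. The remaining equation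
`(1 - t) φ(n) = 0` puts `n` itself in the kernel, since `Λ` is a domain. -/
theorem exists_eq_zsmul_difference_add (m : D.ReducedAlexanderInvariant) :
    ∃ k : ℤ, ∃ n : D.ReducedAlexanderInvariant,
      m = k • P.difference + (1 - T 1 : ℤ[T;T⁻¹]) • n := by
  obtain ⟨k, l, n, hm⟩ := P.exists_eq_zsmul_add m
  have h : D.reducedCrowellMap m = 0 := m.2
  rw [hm] at h
  simp only [map_add, map_zsmul, map_smul, reducedCrowellMap_arcClass, smul_eq_mul, zsmul_eq_mul,
    mul_one] at h
  have hkl : k + l = 0 := by simpa using congrArg augmentation h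
  obtain rfl : l = -k := by omega
  have hn : D.reducedCrowellMap n = 0 := by
    simpa [one_sub_T_ne_zero] using h
  refine ⟨k, ⟨n, hn⟩, Subtype.ext ?_⟩
  rw [hm]
  change _ = k • (D.arcClass P.fst - D.arcClass P.snd) + (1 - T 1 : ℤ[T;T⁻¹]) • n
  module

/-- Relative to the second arc, each component contributes one coset of `(1 - t) K`, and these
cosets depend only on the module `K` and the class of the difference. -/
theorem mem_range_alexanderMap_iff (x : D.ReducedAlexanderInvariant) :
    D.arcClass P.snd + x ∈ Set.range D.alexanderMap ↔
      ∃ n : D.ReducedAlexanderInvariant, x = (1 - T 1 : ℤ[T;T⁻¹]) • n ∨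
        x = P.difference + (1 - T 1 : ℤ[T;T⁻¹]) • n := by
  rw [LinkDiagram.mem_range_alexanderMap_iff]
  constructor
  · rintro ⟨a, m, hm, hx⟩
    rcases P.eq_or_eq a with h | h
    · obtain ⟨n, hn, ha⟩ := exists_arcClass_eq h
      refine ⟨⟨n + m, add_mem hn hm⟩, .inr (Subtype.ext ?_)⟩
      rw [ha] at hx
      change (x : D.ReducedAlexanderModule) =
        (D.arcClass P.fst - D.arcClass P.snd) + (1 - T 1 : ℤ[T;T⁻¹]) • (n + m)
      linear_combination (norm := module) hx
    · obtain ⟨n, hn, ha⟩ := exists_arcClass_eq h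
      refine ⟨⟨n + m, add_mem hn hm⟩, .inl (Subtype.ext ?_)⟩
      rw [ha, add_assoc, ← smul_add] at hx
      exact add_left_cancel hx
  · rintro ⟨n, rfl | rfl⟩
    · exact ⟨P.snd, n, n.2, rfl⟩
    · refine ⟨P.fst, n, n.2, ?_⟩
      change _ + ((D.arcClass P.fst - D.arcClass P.snd) + (1 - T 1 : ℤ[T;T⁻¹]) • n.1) = _
      module

end ArcPair

/-- An isomorphism of reduced Alexander invariants can be chosen so that it respects the differences
of the arcs modulo `1 - t`. -/
theorem exists_equiv_difference {D' : LinkDiagram} (P : D.ArcPair) (P' : D'.ArcPair)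
    (e : D.ReducedAlexanderInvariant ≃ₗ[ℤ[T;T⁻¹]] D'.ReducedAlexanderInvariant) :
    ∃ f : D.ReducedAlexanderInvariant ≃ₗ[ℤ[T;T⁻¹]] D'.ReducedAlexanderInvariant, ∃ n,
      f P.difference = P'.difference + (1 - T 1 : ℤ[T;T⁻¹]) • n := by
  obtain ⟨k, n, hk⟩ := P'.exists_eq_zsmul_difference_add (e P.difference)
  obtain ⟨l, m, hl⟩ := P.exists_eq_zsmul_difference_add (e.symm P'.difference)
  have h := congrArg e hl
  rw [e.apply_symm_apply, map_add, map_zsmul, map_smul, hk] at h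
  have h' : (P'.difference : D'.ReducedAlexanderModule) =
      (l * k) • (P'.difference : D'.ReducedAlexanderModule) +
        (1 - T 1 : ℤ[T;T⁻¹]) • (l • n + e m : D'.ReducedAlexanderInvariant) := by
    refine congrArg Subtype.val (a₂ := (l * k) • P'.difference + (1 - T 1 : ℤ[T;T⁻¹]) •
      (l • n + e m)) ?_
    linear_combination (norm := module) h
  -- Modulo `1 - t`, `e` and its inverse multiply the infinite cyclic generators by `k` and `l`. If
  -- `k = -1`, negation corrects the sign.
  have hkl : l * k = 1 := by
    have h'' := congrArg (D'.componentCount (D'.arcComponent P'.fst)) h'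
    rw [map_add, componentCount_one_sub_T_smul, map_zsmul, P'.componentCount_difference] at h''
    simpa using h''.symm
  rcases Int.isUnit_iff.mp (IsUnit.of_mul_eq_one_right l hkl) with rfl | rfl
  · exact ⟨e, n, by rw [hk, one_smul]⟩
  · refine ⟨e.trans (LinearEquiv.neg _), -n, ?_⟩
    rw [LinearEquiv.trans_apply, hk, LinearEquiv.neg_apply]
    module

/-- An isomorphism of reduced Alexander invariants of classical links with two components gives an
isomorphism of medial quandles. -/
theorem exists_bijective_shelfHom {D' : LinkDiagram} (hD : D.IsClassical) (hD' : D'.IsClassical)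
    (hμ : Nat.card D.Component = 2) (hμ' : Nat.card D'.Component = 2)
    (e : D.ReducedAlexanderInvariant ≃ₗ[ℤ[T;T⁻¹]] D'.ReducedAlexanderInvariant) :
    ∃ f : D.MedialQuandle →◃ D'.MedialQuandle, Function.Bijective f := by
  obtain ⟨P⟩ := nonempty_arcPair hμ
  obtain ⟨P'⟩ := nonempty_arcPair hμ'
  obtain ⟨f, d, hd⟩ := exists_equiv_difference P P' e
  have hinj := hD.alexanderMap_injective hμ
  have hinj' := hD'.alexanderMap_injective hμ'
  -- Taking `P.snd` and `P'.snd` as origins turns `f` into an affine map, which respects `(1 - t) x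
  -- + t y`.
  let rel (x : D.MedialQuandle) : D.ReducedAlexanderInvariant :=
    ⟨D.alexanderMap x - D.arcClass P.snd, alexanderMap_sub_mem x (D.arcElement P.snd)⟩
  have hrel (x) : D.arcClass P.snd + (rel x : D.ReducedAlexanderModule) = D.alexanderMap x :=
    add_sub_cancel _ _
  have hrange (x : D.ReducedAlexanderInvariant) :
      D.arcClass P.snd + x ∈ Set.range D.alexanderMap ↔
        D'.arcClass P'.snd + f x ∈ Set.range D'.alexanderMap := by
    rw [P.mem_range_alexanderMap_iff, P'.mem_range_alexanderMap_iff]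
    constructor
    · rintro ⟨n, rfl | rfl⟩
      · exact ⟨f n, .inl (map_smul _ _ _)⟩
      · exact ⟨d + f n, .inr (by rw [map_add, map_smul, hd]; module)⟩
    · rintro ⟨n, h | h⟩
      · exact ⟨f.symm n, .inl (f.injective (by rw [h, map_smul, f.apply_symm_apply]))⟩
      -- The shift by `d` compensates for `f` preserving the differences only modulo `1 - t`.
      · refine ⟨f.symm (n - d), .inr (f.injective ?_)⟩
        rw [h, map_add, map_smul, f.apply_symm_apply, hd]
        module
  choose g hg using fun x => (hrange (rel x)).mp ⟨x, (hrel x).symm⟩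
  refine ⟨⟨g, fun {x y} => hinj' ?_⟩, fun x y hxy => ?_, fun z => ?_⟩
  · rw [D'.isAlexanderMap_alexanderMap, hg, hg, hg]
    have : rel (x ◃ y) = (1 - T 1 : ℤ[T;T⁻¹]) • rel x + (T 1 : ℤ[T;T⁻¹]) • rel y := by
      apply Subtype.ext
      change D.alexanderMap (x ◃ y) - D.arcClass P.snd =
        (1 - T 1 : ℤ[T;T⁻¹]) • (D.alexanderMap x - D.arcClass P.snd) +
          (T 1 : ℤ[T;T⁻¹]) • (D.alexanderMap y - D.arcClass P.snd)
      rw [D.isAlexanderMap_alexanderMap]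
      module
    rw [this, map_add, map_smul, map_smul, Submodule.coe_add, Submodule.coe_smul,
      Submodule.coe_smul]
    module
  · have h := congrArg D'.alexanderMap (show g x = g y from hxy)
    rw [hg, hg] at h
    apply hinj
    rw [← hrel, ← hrel, f.injective (Subtype.ext (add_left_cancel h))]
  · let w : D'.ReducedAlexanderInvariant :=
      ⟨D'.alexanderMap z - D'.arcClass P'.snd, alexanderMap_sub_mem z (D'.arcElement P'.snd)⟩
    have hw : D'.arcClass P'.snd + (w : D'.ReducedAlexanderModule) = D'.alexanderMap z :=
      add_sub_cancel _ _
    obtain ⟨x, hx⟩ := (hrange (f.symm w)).mpr (by rw [f.apply_symm_apply]; exact ⟨z, hw.symm⟩)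
    refine ⟨x, hinj' ?_⟩
    change D'.alexanderMap (g x) = _
    have : rel x = f.symm w := Subtype.ext (add_left_cancel ((hrel x).trans hx))
    rw [hg, this, f.apply_symm_apply, hw]

end LinkDiagram

theorem mainTheorem3 (D D' : LinkDiagram)
    (hD : D.IsClassical) (hD' : D'.IsClassical)
    (hμ : Nat.card D.Component = 2) (hμ' : Nat.card D'.Component = 2) :
    (∃ f : D.MedialQuandle →◃ D'.MedialQuandle, Function.Bijective f) ↔
      Nonempty (D.ReducedAlexanderInvariant ≃ₗ[ℤ[T;T⁻¹]] D'.ReducedAlexanderInvariant) := by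
  constructor
  · rintro ⟨f, hf⟩
    exact LinkDiagram.nonempty_invariant_equiv f hf
  · rintro ⟨e⟩
    exact LinkDiagram.exists_bijective_shelfHom hD hD' hμ hμ' e
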